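/- A circular arc is a closed nondegenerate line segment or a closed nondegenerate connected portion of a circle in $\mathbb{R}^2$ (possibly the whole circle, with one of its points as the only endpoint). A circular domain is a closed set $R \subseteq \mathbb{R}^2$ whose boundary $\partial R$ is the union of finitely many circular arcs, any two of which meet only at common endpoints, together with finitely many single points lying on none of the arcs (so every finite set of points is a circular domain). Its complexity $\lVert R\rVert$ is the total number of arcs and vertices of $\partial R$, where the vertices are the points at which two different arcs meet and the single points; the number is taken for a decomposition of $\partial R$ that minimizes it. (For a finite set of points, $\lVert R\rVert$ is the number of points.) Let $D=\{(x,y)\in\mathbb{R}^2 : x^2+y^2\le 1\}$ and $A\oplus B=\{a+b : a\in A,\ b\in B\}$. Lemma. There is an absolute constant $C$ with the following property. Let $0<\varepsilon\le 0.1$ and let $R_1,\dots,R_r$ be circular domains, each of which is contained in an $\varepsilon\times\varepsilon$ grid cell, i.e. in a closed axis-parallel square of side length $\varepsilon$ (the squares may differ for different $i$). Then every $R_i\oplus D$ and the intersection $\bigcap_{i=1}^r (R_i\oplus D)$ are circular domains, and $$\Big\lVert \bigcap_{i=1}^r (R_i\oplus D)\Big\rVert \le C\, r^2 M, \qquad M=\max_{1\le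 i\le r}\lVert R_i\oplus D\rVert .$$ -/

import Mathlib

open scoped Pointwise

/-- The Euclidean plane. -/
abbrev Plane : Type := EuclideanSpace ℝ (Fin 2)

/-- The point at angle `t` on the circle of radius `ρ` around `c`. -/
noncomputable def circlePoint (c : Plane) (ρ t : ℝ) : Plane :=
  c + !₂[ρ * Real.cos t, ρ * Real.sin t]

/-- A (closed, nondegenerate) circular arc: either a line segment with two distinct endpoints, or
the portion of the circle of centre `c` and radius `ρ > 0` swept counterclockwise from angle `θ`
to angle `θ + φ`, where `0 < φ ≤ 2π`. The value `φ = 2π` gives a full circle, whose two endpoints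
coincide. -/
inductive CircularArc : Type
  | segment (a b : Plane) (hab : a ≠ b) : CircularArc
  | arc (c : Plane) (ρ θ φ : ℝ) (hρ : 0 < ρ) (hφ : 0 < φ) (hφ' : φ ≤ 2 * Real.pi) : CircularArc

namespace CircularArc

/-- The set of points of a circular arc. -/
def carrier : CircularArc → Set Plane
  | segment a b _ => _root_.segment ℝ a b
  | arc c ρ θ φ _ _ _ => circlePoint c ρ '' Set.Icc θ (θ + φ)

/-- The endpoints of a circular arc. -/
def endpoints : CircularArc → Set Plane
  | segment a b _ => {a, b}
  | arc c ρ θ φ _ _ _ => {circlePoint c ρ θ, circlePoint c ρ (θ + φ)}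

theorem endpoints_finite (σ : CircularArc) : σ.endpoints.Finite := by
  cases σ <;> simp [endpoints]

end CircularArc

/-- A way of writing a set `B` of points as a union of finitely many circular arcs, any two of
which meet only at common endpoints, and finitely many further points lying on none of the arcs. -/
structure CircularDecomposition (B : Set Plane) where
  /-- the arcs -/
  arcs : Finset CircularArc
  /-- the points of `B` that are on no arc -/
  points : Finset Plane
  union_eq : (⋃ σ ∈ arcs, σ.carrier) ∪ (points : Set Plane) = B
  inter_subset : ∀ σ ∈ arcs, ∀ τ ∈ arcs, σ ≠ τ →
    σ.carrier ∩ τ.carrier ⊆ σ.endpoints ∩ τ.endpoints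
  points_off_arcs : ∀ p ∈ points, ∀ σ ∈ arcs, p ∉ σ.carrier

namespace CircularDecomposition

/-- The vertices: the points at which two different arcs meet, and the points on no arc. -/
def vertices {B : Set Plane} (d : CircularDecomposition B) : Set Plane :=
  {p | ∃ σ ∈ d.arcs, ∃ τ ∈ d.arcs, σ ≠ τ ∧ p ∈ σ.carrier ∩ τ.carrier} ∪ (d.points : Set Plane)

theorem vertices_finite {B : Set Plane} (d : CircularDecomposition B) : d.vertices.Finite := by
  refine Set.Finite.union ?_ d.points.finite_toSet
  refine (d.arcs.finite_toSet.biUnion fun σ _ => σ.endpoints_finite).subset ?_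
  rintro p ⟨σ, hσ, τ, hτ, hne, hp⟩
  exact Set.mem_biUnion hσ (d.inter_subset σ hσ τ hτ hne hp).1

/-- The total number of arcs and vertices. -/
noncomputable def size {B : Set Plane} (d : CircularDecomposition B) : ℕ :=
  d.arcs.card + d.vertices.ncard

end CircularDecomposition

/-- A circular domain: a closed subset of the plane whose boundary consists of finitely many
circular arcs that meet only at their endpoints (and possibly finitely many single points; in
particular every finite set of points is a circular domain). -/
def IsCircularDomain (R : Set Plane) : Prop :=
  IsClosed R ∧ Nonempty (CircularDecomposition (frontier R))

/-- The complexity of a circular domain: the total number of arcs and vertices of its boundary.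
The boundary is taken without superfluous subdivision points, that is, the number is the least
one over all decompositions of the boundary. For a finite set of points this is the number
of points. -/
noncomputable def circularComplexity (R : Set Plane) : ℕ :=
  sInf {n | ∃ d : CircularDecomposition (frontier R), d.size = n}

/-- The closed unit disk centred at the origin. -/
def unitDisk : Set Plane := Metric.closedBall 0 1

/-- The `ε × ε` grid cell (closed axis-parallel square of side length `ε`) with lower left
corner `a`. -/
def gridCell (a : Plane) (ε : ℝ) : Set Plane :=
  {p | ∀ j, a j ≤ p j ∧ p j ≤ a j + ε}

/-!
The boundary of a neighbourhood `S = R ⊕ D` of a set `R` inside a small cell with corner `a` looks,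
near each of its points `p`, like the graph of a function over a line orthogonal to `p - a`. Indeed
a unit disk contained in `S` touches the boundary at `p`, and its centre is close to `a`. Hence the
radial direction at `p` leads from the interior of `S` to its complement
(`sub_smul_mem_interior`, `add_smul_notMem`), and chords of the boundary near `p` are never almost
radial (`frontier_injOn_direction`).

*Circular domains.* A boundary point has distance one to its nearest point in `R`, so that it lies
on a unit circle around an endpoint of an arc or a single point of the boundary of `R`, on a line
parallel to one of its segments, or on a circle concentric with one of its circular arcs, up to
finitely many exceptions (`frontier_subset_curves`). Away from the intersections of these
finitely many lines and circles the boundary locally lies on one of them, and by the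
intermediate value theorem in radial direction it locally fills it
(`frontier_mem_nhdsWithin_curve`). A set of this kind can be cut into arcs
(`exists_circularDecomposition`).

*The bound.* The boundary of `⋂ i, S i` consists of the points of the intersection that lie on the
boundary of some `S i`. It is cut into arcs at the endpoints of the arcs of all the boundaries and
at the crossings of arcs on different lines or circles; two such arcs cross at most twice. It
remains to bound the number of pairs of meeting arcs of two boundaries with at most `M` arcs each by
`O(M)`, which gives `O(r² M)` in total. All arcs are divided into boundedly many short pieces. At a common
point `p` of two boundaries one of three fixed projections is injective near `p` on both boundaries
at once (`exists_direction`, `frontier_injOn_transverse`), even when the cells are far apart and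
the boundaries nearly touch from opposite sides. So short pieces behave like intervals of two
families with disjoint interiors: of two meeting intervals one contains the left end of the other,
and a given point lies in at most two intervals of each family
(`card_intersecting_pairs_le`, `card_meeting_arcs_le`).
-/

/-! ### Arcs and their parametrisations -/

theorem circlePoint_apply_zero (c : Plane) (ρ t : ℝ) :
    circlePoint c ρ t 0 = c 0 + ρ * Real.cos t := by simp [circlePoint]

theorem circlePoint_apply_one (c : Plane) (ρ t : ℝ) :
    circlePoint c ρ t 1 = c 1 + ρ * Real.sin t := by simp [circlePoint]

theorem plane_ext {x y : Plane} (h0 : x 0 = y 0) (h1 : x 1 = y 1) : x = y := by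
  ext i; fin_cases i <;> assumption

theorem plane_dist_sq (x y : Plane) : dist x y ^ 2 = (x 0 - y 0) ^ 2 + (x 1 - y 1) ^ 2 := by
  rw [EuclideanSpace.dist_eq, Real.sq_sqrt (by positivity)]
  simp [Fin.sum_univ_two, Real.dist_eq, sq_abs]

theorem plane_norm_sq (x : Plane) : ‖x‖ ^ 2 = x 0 ^ 2 + x 1 ^ 2 := by
  simpa using plane_dist_sq x 0

theorem dist_circlePoint_center (c : Plane) {ρ : ℝ} (hρ : 0 ≤ ρ) (t : ℝ) :
    dist (circlePoint c ρ t) c = ρ := by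
  rw [← sq_eq_sq₀ dist_nonneg hρ, plane_dist_sq, circlePoint_apply_zero, circlePoint_apply_one]
  linear_combination ρ ^ 2 * Real.sin_sq_add_cos_sq t

theorem dist_circlePoint_sq (c : Plane) (ρ s t : ℝ) :
    dist (circlePoint c ρ s) (circlePoint c ρ t) ^ 2 = (2 * ρ * Real.sin ((s - t) / 2)) ^ 2 := by
  have h := Real.cos_sq ((s - t) / 2)
  rw [mul_div_cancel₀ _ (two_ne_zero' ℝ), Real.cos_sub] at h
  have h' := Real.sin_sq_add_cos_sq ((s - t) / 2)
  rw [plane_dist_sq, circlePoint_apply_zero, circlePoint_apply_one, circlePoint_apply_zero,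
    circlePoint_apply_one]
  linear_combination ρ ^ 2 * (Real.sin_sq_add_cos_sq s + Real.sin_sq_add_cos_sq t - 4 * h' + 4 * h)

theorem dist_circlePoint (c : Plane) {ρ : ℝ} (hρ : 0 ≤ ρ) (s t : ℝ) :
    dist (circlePoint c ρ s) (circlePoint c ρ t) = 2 * ρ * |Real.sin ((s - t) / 2)| := by
  rw [← Real.sqrt_sq (dist_nonneg (x := circlePoint c ρ s)), dist_circlePoint_sq,
    Real.sqrt_sq_eq_abs, abs_mul, abs_of_nonneg (by positivity : 0 ≤ 2 * ρ)]

theorem dist_circlePoint_le (c : Plane) {ρ : ℝ} (hρ : 0 ≤ ρ) (s t : ℝ) :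
    dist (circlePoint c ρ s) (circlePoint c ρ t) ≤ ρ * |s - t| := by
  rw [dist_circlePoint c hρ]
  have h : |Real.sin ((s - t) / 2)| ≤ |(s - t) / 2| := Real.abs_sin_le_abs
  rw [abs_div, abs_of_pos (by norm_num : (0 : ℝ) < 2)] at h
  nlinarith

theorem continuous_circlePoint (c : Plane) (ρ : ℝ) : Continuous (circlePoint c ρ) := by
  rw [Metric.continuous_iff]
  intro t e he
  refine ⟨e / (|ρ| + 1), by positivity, fun s hs => ?_⟩
  have h2 : dist (circlePoint c ρ s) (circlePoint c ρ t) ≤ |ρ| * |s - t| := by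
    refine abs_le_of_sq_le_sq' ?_ (by positivity) |>.2
    rw [dist_circlePoint_sq, mul_pow, mul_pow, mul_pow, sq_abs, sq_abs]
    have h : |Real.sin ((s - t) / 2)| ≤ |(s - t) / 2| := Real.abs_sin_le_abs
    have h' := sq_le_sq.2 h
    nlinarith [sq_nonneg ρ]
  rw [Real.dist_eq, lt_div_iff₀ (by positivity)] at hs
  nlinarith [abs_nonneg (s - t)]

/-- Two angles of the same point of a circle differ by `0` or `2π` if they are at most a full turn
apart. -/
theorem circlePoint_inj {c : Plane} {ρ s t : ℝ} (hρ : 0 < ρ)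
    (h : circlePoint c ρ s = circlePoint c ρ t)
    (hst : |s - t| ≤ 2 * Real.pi) : s = t ∨ s = t + 2 * Real.pi ∨ t = s + 2 * Real.pi := by
  have h0 := congrArg (fun x : Plane => x 0) h
  have h1 := congrArg (fun x : Plane => x 1) h
  simp only [circlePoint_apply_zero, circlePoint_apply_one, add_right_inj,
    mul_right_inj' hρ.ne'] at h0 h1
  obtain ⟨k, hk⟩ := Real.Angle.angle_eq_iff_two_pi_dvd_sub.1 (Real.Angle.cos_sin_inj h0 h1)
  have hpi := Real.pi_pos
  rw [hk, abs_mul, abs_of_pos (by positivity)] at hst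
  have hk1 : |(k : ℝ)| ≤ 1 := by
    by_contra! hc
    nlinarith
  have hk2 : |k| ≤ 1 := by exact_mod_cast hk1
  obtain ⟨h3, h4⟩ := abs_le.1 hk2
  interval_cases k
  · right; right; push_cast at hk; linarith
  · left; push_cast at hk; linarith
  · right; left; push_cast at hk; linarith

theorem sphere_eq_image_circlePoint (c : Plane) {ρ : ℝ} (hρ : 0 < ρ) (θ : ℝ) :
    Metric.sphere c ρ = circlePoint c ρ '' Set.Icc θ (θ + 2 * Real.pi) := by
  apply Set.Subset.antisymm
  · intro x hx
    have hx' : (x 0 - c 0) ^ 2 + (x 1 - c 1) ^ 2 = ρ ^ 2 := by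
      rw [← plane_dist_sq, Metric.mem_sphere.1 hx]
    set z : ℂ := ⟨x 0 - c 0, x 1 - c 1⟩ with hz
    have hn : ‖z‖ = ρ := by
      rw [← Real.sqrt_sq hρ.le, ← hx', Complex.norm_def, Complex.normSq_mk]
      congr 1; ring
    have h0 : ρ * Real.cos z.arg = x 0 - c 0 := by rw [← hn, Complex.norm_mul_cos_arg]
    have h1 : ρ * Real.sin z.arg = x 1 - c 1 := by rw [← hn, Complex.norm_mul_sin_arg]
    obtain ⟨m, hm, -⟩ := existsUnique_add_zsmul_mem_Ico Real.two_pi_pos z.arg θ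
    refine ⟨z.arg + m • (2 * Real.pi), Set.Ico_subset_Icc_self hm, ?_⟩
    rw [zsmul_eq_mul]
    apply plane_ext
    · rw [circlePoint_apply_zero, Real.cos_add_int_mul_two_pi, h0]; ring
    · rw [circlePoint_apply_one, Real.sin_add_int_mul_two_pi, h1]; ring
  · rintro _ ⟨t, -, rfl⟩
    exact dist_circlePoint_center c hρ.le t

namespace CircularArc

/-- The parametrisation of a circular arc by the unit interval, affine for a segment and
proportional to the angle for an arc of a circle. -/
noncomputable def param : CircularArc → ℝ → Plane
  | segment a b _, t => AffineMap.lineMap a b t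
  | arc c ρ θ φ _ _ _, t => circlePoint c ρ (θ + t * φ)

theorem continuous_param (σ : CircularArc) : Continuous σ.param := by
  cases σ with
  | segment a b hab => exact AffineMap.lineMap_continuous
  | arc c ρ θ φ hρ hφ hφ' =>
    exact (continuous_circlePoint c ρ).comp (by fun_prop)

theorem image_affine_Icc {φ : ℝ} (hφ : 0 < φ) (θ s t : ℝ) :
    (fun x => θ + x * φ) '' Set.Icc s t = Set.Icc (θ + s * φ) (θ + t * φ) := by
  ext y
  constructor
  · rintro ⟨x, ⟨h1, h2⟩, rfl⟩
    constructor <;> dsimp only <;> nlinarith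
  · rintro ⟨h1, h2⟩
    refine ⟨(y - θ) / φ, ⟨?_, ?_⟩, by dsimp only; field_simp; ring⟩
    · rw [le_div_iff₀ hφ]; linarith
    · rw [div_le_iff₀ hφ]; linarith

theorem carrier_eq (σ : CircularArc) : σ.carrier = σ.param '' Set.Icc 0 1 := by
  cases σ with
  | segment a b hab => exact segment_eq_image_lineMap ℝ a b
  | arc c ρ θ φ hρ hφ hφ' =>
    have := image_affine_Icc hφ θ 0 1
    simp only [zero_mul, add_zero, one_mul] at this
    rw [carrier, ← this, Set.image_image]
    rfl

theorem endpoints_eq (σ : CircularArc) : σ.endpoints = {σ.param 0, σ.param 1} := by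
  cases σ <;> simp [endpoints, param]

theorem isCompact_carrier (σ : CircularArc) : IsCompact σ.carrier := by
  rw [carrier_eq]; exact isCompact_Icc.image σ.continuous_param

theorem endpoints_subset (σ : CircularArc) : σ.endpoints ⊆ σ.carrier := by
  rw [endpoints_eq, carrier_eq]
  rintro _ (rfl | rfl)
  exacts [⟨0, by simp, rfl⟩, ⟨1, by simp, rfl⟩]

theorem param_inj (σ : CircularArc) {s t : ℝ} (hs : s ∈ Set.Icc (0 : ℝ) 1)
    (ht : t ∈ Set.Icc (0 : ℝ) 1) (h : σ.param s = σ.param t) :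
    s = t ∨ (s = 0 ∧ t = 1) ∨ (s = 1 ∧ t = 0) := by
  cases σ with
  | segment a b hab => exact Or.inl (AffineMap.lineMap_injective ℝ hab h)
  | arc c ρ θ φ hρ hφ hφ' =>
    obtain ⟨hs0, hs1⟩ := hs
    obtain ⟨ht0, ht1⟩ := ht
    have hpi := Real.pi_pos
    have hb : |θ + s * φ - (θ + t * φ)| ≤ 2 * Real.pi := by
      rw [abs_le]; constructor <;> nlinarith
    rcases circlePoint_inj hρ h hb with h | h | h
    · left
      have : (s - t) * φ = 0 := by linarith
      rcases mul_eq_zero.1 this with h | h <;> linarith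
    · right; right
      constructor <;> nlinarith
    · right; left
      constructor <;> nlinarith

theorem exists_subarc (σ : CircularArc) {s t : ℝ} (hs : 0 ≤ s) (hst : s < t) (ht : t ≤ 1) :
    ∃ τ : CircularArc, τ.carrier = σ.param '' Set.Icc s t ∧
      τ.endpoints = {σ.param s, σ.param t} := by
  cases σ with
  | segment a b hab =>
    have hne : AffineMap.lineMap a b s ≠ AffineMap.lineMap a b t := fun h =>
      hst.ne (AffineMap.lineMap_injective ℝ hab h)
    refine ⟨.segment (AffineMap.lineMap a b s) (AffineMap.lineMap a b t) hne, ?_, rfl⟩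
    have := image_segment ℝ (AffineMap.lineMap a b : ℝ →ᵃ[ℝ] Plane) s t
    rw [segment_eq_Icc hst.le] at this
    exact this.symm
  | arc c ρ θ φ hρ hφ hφ' =>
    refine ⟨.arc c ρ (θ + s * φ) ((t - s) * φ) hρ (mul_pos (by linarith) hφ) (by nlinarith), ?_, ?_⟩
    · have := image_affine_Icc hφ θ s t
      have h2 : θ + s * φ + (t - s) * φ = θ + t * φ := by ring
      rw [carrier, h2, ← this, Set.image_image]
      rfl
    · have h2 : θ + s * φ + (t - s) * φ = θ + t * φ := by ring
      rw [endpoints, h2]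
      rfl

/-- The full line or circle on which a circular arc lies. -/
def curve : CircularArc → Set Plane
  | segment a b _ => line[ℝ, a, b]
  | arc c ρ _ _ _ _ _ => Metric.sphere c ρ

theorem carrier_subset_curve (σ : CircularArc) : σ.carrier ⊆ σ.curve := by
  rw [carrier_eq]
  rintro _ ⟨t, -, rfl⟩
  cases σ with
  | segment a b hab => exact AffineMap.lineMap_mem_affineSpan_pair t a b
  | arc c ρ θ φ hρ hφ hφ' => exact dist_circlePoint_center c hρ.le _

/-- Away from its endpoints, an arc is relatively open in the line or circle carrying it. -/
theorem carrier_mem_nhdsWithin_curve (σ : CircularArc) {p : Plane} (hp : p ∈ σ.carrier)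
    (hp' : p ∉ σ.endpoints) : σ.carrier ∈ nhdsWithin p σ.curve := by
  cases σ with
  | segment a b hab =>
    rw [carrier_eq] at hp ⊢
    rw [endpoints_eq] at hp'
    obtain ⟨t, ht, rfl⟩ := hp
    -- the affine coordinate along the line extends continuously to the plane
    set f : Plane → ℝ := fun x => inner ℝ (x - a) (b - a) / ‖b - a‖ ^ 2 with hf
    have hba : ‖b - a‖ ^ 2 ≠ 0 := by
      have := norm_pos_iff.2 (sub_ne_zero.2 hab.symm); positivity
    have hft : ∀ t : ℝ, f (AffineMap.lineMap a b t) = t := by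
      intro t
      simp only [hf, AffineMap.lineMap_apply, vsub_eq_sub, vadd_eq_add, add_sub_cancel_right,
        real_inner_smul_left, real_inner_self_eq_norm_sq]
      exact mul_div_cancel_right₀ t hba
    have hfc : Continuous f := by fun_prop
    have h0 : t ≠ 0 := by rintro rfl; simp at hp'
    have h1 : t ≠ 1 := by rintro rfl; simp at hp'
    have hmem : f (param (segment a b hab) t) ∈ Set.Ioo (0 : ℝ) 1 := by
      simp only [param]
      rw [hft]
      exact ⟨lt_of_le_of_ne ht.1 h0.symm, lt_of_le_of_ne ht.2 h1⟩
    have hU := (isOpen_Ioo.preimage hfc).mem_nhds hmem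
    refine mem_nhdsWithin_iff_exists_mem_nhds_inter.2 ⟨_, hU, ?_⟩
    rintro x ⟨hx, hxl⟩
    obtain ⟨s, rfl⟩ := mem_affineSpan_pair_iff_exists_lineMap_eq.1 hxl
    rw [Set.mem_preimage, hft] at hx
    exact ⟨s, Set.Ioo_subset_Icc_self hx, rfl⟩
  | arc c ρ θ φ hρ hφ hφ' =>
    -- the closed complementary arc stays away from `p`
    have hcl : IsClosed (circlePoint c ρ '' Set.Icc (θ + φ) (θ + 2 * Real.pi)) :=
      (isCompact_Icc.image (continuous_circlePoint c ρ)).isClosed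
    have hpn : p ∉ circlePoint c ρ '' Set.Icc (θ + φ) (θ + 2 * Real.pi) := by
      rintro ⟨s, ⟨hs1, hs2⟩, hs⟩
      obtain ⟨t, ⟨ht1, ht2⟩, rfl⟩ := hp
      simp only [endpoints, Set.mem_insert_iff, Set.mem_singleton_iff, not_or] at hp'
      have hpi := Real.pi_pos
      have hb : |s - t| ≤ 2 * Real.pi := by
        rw [abs_le]; constructor <;> linarith
      rcases circlePoint_inj hρ hs hb with h | h | h
      · exact hp'.2 (by congr 1; linarith)
      · exact hp'.1 (by congr 1; linarith)
      · linarith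
    refine mem_nhdsWithin_iff_exists_mem_nhds_inter.2 ⟨_, hcl.isOpen_compl.mem_nhds hpn, ?_⟩
    rintro x ⟨hx, hxc⟩
    change x ∈ Metric.sphere c ρ at hxc
    rw [sphere_eq_image_circlePoint c hρ θ] at hxc
    obtain ⟨s, hs, rfl⟩ := hxc
    refine ⟨s, ⟨hs.1, ?_⟩, rfl⟩
    by_contra! hlt
    exact hx ⟨s, ⟨hlt.le, hs.2⟩, rfl⟩

/-- Every bounded part of the line or circle carrying an arc lies in a single arc of it. -/
theorem exists_arc_of_isBounded (σ : CircularArc) {B : Set Plane} (hB : Bornology.IsBounded B) :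
    ∃ τ : CircularArc, τ.carrier ⊆ σ.curve ∧ σ.curve ∩ B ⊆ τ.carrier := by
  cases σ with
  | segment a b hab =>
    have hba : 0 < ‖b - a‖ := norm_pos_iff.2 (sub_ne_zero.2 hab.symm)
    obtain ⟨N, hN⟩ := hB.subset_closedBall a
    set m : ℝ := max N 1 / ‖b - a‖ with hm
    have hmpos : 0 < m := by positivity
    have hne : AffineMap.lineMap a b (-m) ≠ AffineMap.lineMap a b m := fun h => by
      have := AffineMap.lineMap_injective ℝ hab h
      linarith
    have him : (AffineMap.lineMap a b : ℝ → Plane) '' Set.Icc (-m) m =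
        (segment (AffineMap.lineMap a b (-m)) (AffineMap.lineMap a b m) hne).carrier := by
      have := image_segment ℝ (AffineMap.lineMap a b : ℝ →ᵃ[ℝ] Plane) (-m) m
      rw [segment_eq_Icc (by linarith)] at this
      exact this
    refine ⟨.segment (AffineMap.lineMap a b (-m)) (AffineMap.lineMap a b m) hne, ?_, ?_⟩
    · rw [← him]
      rintro _ ⟨t, -, rfl⟩
      exact AffineMap.lineMap_mem_affineSpan_pair t a b
    · rintro x ⟨hx, hxB⟩
      obtain ⟨t, rfl⟩ := mem_affineSpan_pair_iff_exists_lineMap_eq.1 hx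
      rw [← him]
      refine ⟨t, ?_, rfl⟩
      have h := Metric.mem_closedBall.1 (hN hxB)
      rw [dist_lineMap_left, dist_comm a b, dist_eq_norm, Real.norm_eq_abs] at h
      rw [Set.mem_Icc, ← abs_le, hm, le_div_iff₀ hba]
      exact h.trans (le_max_left _ _)
  | arc c ρ θ φ hρ hφ hφ' =>
    refine ⟨.arc c ρ 0 (2 * Real.pi) hρ Real.two_pi_pos le_rfl, ?_, ?_⟩
    · rw [carrier, ← sphere_eq_image_circlePoint c hρ]; rfl
    · rw [carrier, ← sphere_eq_image_circlePoint c hρ]; exact Set.inter_subset_left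

/-- A line and a circle have at most two common points. -/
theorem eq_or_eq_of_mem_line_of_mem_sphere {a b c : Plane} {ρ : ℝ} {x y z : Plane} (hxy : x ≠ y)
    (hx : x ∈ line[ℝ, a, b]) (hy : y ∈ line[ℝ, a, b]) (hz : z ∈ line[ℝ, a, b])
    (hx' : x ∈ Metric.sphere c ρ) (hy' : y ∈ Metric.sphere c ρ) (hz' : z ∈ Metric.sphere c ρ) :
    z = x ∨ z = y := by
  rw [← affineSpan_pair_eq_of_mem_of_mem_of_ne hx hy hxy] at hz
  obtain ⟨t, rfl⟩ := mem_affineSpan_pair_iff_exists_lineMap_eq.1 hz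
  have hρ : 0 ≤ ρ := hx' ▸ dist_nonneg
  rw [mem_sphere_iff_norm, ← sq_eq_sq₀ (norm_nonneg _) hρ] at hx' hy' hz'
  have e1 : AffineMap.lineMap x y t - c = (x - c) + t • (y - x) := by
    rw [AffineMap.lineMap_apply, vsub_eq_sub, vadd_eq_add]; abel
  have e2 : y - c = (x - c) + (y - x) := by abel
  rw [e1, norm_add_sq_real, norm_smul, real_inner_smul_right, mul_pow, Real.norm_eq_abs,
    sq_abs] at hz'
  rw [e2, norm_add_sq_real] at hy'
  have hpos : ‖y - x‖ ^ 2 ≠ 0 := by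
    have := norm_pos_iff.2 (sub_ne_zero.2 hxy.symm); positivity
  have hprod : t * (t - 1) * ‖y - x‖ ^ 2 = 0 := by
    linear_combination hz' - t * hy' + (t - 1) * hx'
  rcases mul_eq_zero.1 ((mul_eq_zero.1 hprod).resolve_right hpos) with h | h
  · left; rw [h, AffineMap.lineMap_apply_zero]
  · right; rw [sub_eq_zero.1 h, AffineMap.lineMap_apply_one]

/-- Two different lines or circles have at most two common points. -/
theorem eq_or_eq_of_curve_ne {σ τ : CircularArc} (h : σ.curve ≠ τ.curve) {x y z : Plane}
    (hxy : x ≠ y) (hx : x ∈ σ.curve ∩ τ.curve) (hy : y ∈ σ.curve ∩ τ.curve)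
    (hz : z ∈ σ.curve ∩ τ.curve) : z = x ∨ z = y := by
  cases σ with
  | segment a b hab =>
    cases τ with
    | segment a' b' hab' =>
      refine absurd ?_ h
      have h1 := affineSpan_pair_eq_of_mem_of_mem_of_ne hx.1 hy.1 hxy
      have h2 := affineSpan_pair_eq_of_mem_of_mem_of_ne hx.2 hy.2 hxy
      simp only [curve, ← h1, ← h2]
    | arc c ρ θ φ hρ hφ hφ' =>
      exact eq_or_eq_of_mem_line_of_mem_sphere hxy hx.1 hy.1 hz.1 hx.2 hy.2 hz.2
  | arc c ρ θ φ hρ hφ hφ' =>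
    cases τ with
    | segment a' b' hab' =>
      exact eq_or_eq_of_mem_line_of_mem_sphere hxy hx.2 hy.2 hz.2 hx.1 hy.1 hz.1
    | arc c' ρ' θ' φ' hρ' hφ1 hφ2 =>
      have hne : (⟨c, ρ⟩ : EuclideanGeometry.Sphere Plane) ≠ ⟨c', ρ'⟩ := by
        intro he
        simp only [EuclideanGeometry.Sphere.mk.injEq] at he
        exact h (by simp only [curve, he])
      exact EuclideanGeometry.eq_of_mem_sphere_of_mem_sphere_of_finrank_eq_two
        (by simp) hne hxy hx.1 hy.1 hz.1 hx.2 hy.2 hz.2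

theorem exists_inter_curve_subset_pair {σ τ : CircularArc} (h : σ.curve ≠ τ.curve) :
    ∃ x y : Plane, σ.curve ∩ τ.curve ⊆ {x, y} := by
  by_cases hs : (σ.curve ∩ τ.curve).Subsingleton
  · rcases hs.eq_empty_or_singleton with h0 | ⟨x, hx⟩
    · exact ⟨0, 0, by simp [h0]⟩
    · exact ⟨x, x, by simp [hx]⟩
  · obtain ⟨x, hx, y, hy, hxy⟩ := Set.not_subsingleton_iff.1 hs
    exact ⟨x, y, fun z hz => eq_or_eq_of_curve_ne h hxy hx hy hz⟩

end CircularArc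

/-! ### Cutting closed subsets of arcs into arcs -/

namespace CircularArc

/-- A closed subset `F` of an arc that is relatively open away from a finite set `V` is a union of
arcs between consecutive points of `V` (or ends of the given arc) and of finitely many points. -/
theorem exists_subdivision (σ : CircularArc) {F : Set Plane} (V : Finset Plane)
    (hFσ : F ⊆ σ.carrier) (hF : IsClosed F)
    (hloc : ∀ x ∈ F, x ∉ V → F ∈ nhdsWithin x σ.carrier) :
    ∃ (A : Finset CircularArc) (Q : Finset Plane),
      A.card ≤ V.card + 2 ∧ Q.card ≤ V.card + 2 ∧
      (∀ τ ∈ A, τ.carrier ⊆ F) ∧ (∀ τ ∈ A, τ.endpoints ⊆ Q) ∧ (Q : Set Plane) ⊆ F ∧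
      (∀ τ ∈ A, τ.carrier ∩ V ⊆ τ.endpoints) ∧
      (∀ τ ∈ A, ∀ τ' ∈ A, τ ≠ τ' → τ.carrier ∩ τ'.carrier ⊆ τ.endpoints ∩ τ'.endpoints) ∧
      F ⊆ (⋃ τ ∈ A, τ.carrier) ∪ Q := by
  classical
  set g : Plane → ℝ := Function.invFunOn σ.param (Set.Icc 0 1) with hg
  set T : Finset ℝ := insert 0 (insert 1 ((V.image g).filter (· ∈ Set.Icc (0 : ℝ) 1))) with hT
  have hTcard : T.card ≤ V.card + 2 := by
    refine (Finset.card_insert_le _ _).trans (Nat.succ_le_succ ?_)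
    refine (Finset.card_insert_le _ _).trans (Nat.succ_le_succ ?_)
    exact (Finset.card_filter_le _ _).trans Finset.card_image_le
  have h0T : (0 : ℝ) ∈ T := by simp [hT]
  have h1T : (1 : ℝ) ∈ T := by simp [hT]
  have hT01 : ∀ t ∈ T, t ∈ Set.Icc (0 : ℝ) 1 := by
    intro t ht
    simp only [hT, Finset.mem_insert, Finset.mem_filter] at ht
    rcases ht with rfl | rfl | ht
    exacts [by simp, by simp, ht.2]
  have hVT : ∀ t ∈ Set.Icc (0 : ℝ) 1, σ.param t ∈ V → t ∈ T := by
    intro t ht htV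
    have hex : ∃ a ∈ Set.Icc (0 : ℝ) 1, σ.param a = σ.param t := ⟨t, ht, rfl⟩
    have h1 := Function.invFunOn_mem hex
    have h2 := Function.invFunOn_eq hex
    rcases σ.param_inj h1 ht h2 with h | h | h
    · have : g (σ.param t) = t := h
      simp only [hT, Finset.mem_insert, Finset.mem_filter, Finset.mem_image]
      exact Or.inr (Or.inr ⟨⟨_, htV, this⟩, ht⟩)
    · rw [h.2]; exact h1T
    · rw [h.2]; exact h0T
  -- pairs of consecutive parameters whose arc lies in `F`
  set E : Finset (ℝ × ℝ) := (T ×ˢ T).filter (fun e => e.1 < e.2 ∧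
    (∀ x ∈ T, ¬ (e.1 < x ∧ x < e.2)) ∧ σ.param '' Set.Icc e.1 e.2 ⊆ F) with hE
  have hEcard : E.card ≤ T.card := by
    refine Finset.card_le_card_of_injOn Prod.fst ?_ ?_
    · intro e he
      simp only [hE, Finset.coe_filter, Finset.mem_product, Set.mem_ofPred_eq] at he
      exact he.1.1
    · intro e he e' he' h
      simp only [hE, Finset.coe_filter, Finset.mem_product, Set.mem_ofPred_eq] at he he'
      refine Prod.ext h ?_
      by_contra hne
      rcases lt_or_gt_of_ne hne with hlt | hlt
      · exact he'.2.2.1 _ he.1.2 ⟨h ▸ he.2.1, hlt⟩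
      · exact he.2.2.1 _ he'.1.2 ⟨h ▸ he'.2.1, hlt⟩
  have hex : ∀ e : ℝ × ℝ, ∃ τ : CircularArc, e ∈ E →
      τ.carrier = σ.param '' Set.Icc e.1 e.2 ∧ τ.endpoints = {σ.param e.1, σ.param e.2} := by
    intro e
    by_cases he : e ∈ E
    · have he' := he
      simp only [hE, Finset.mem_filter, Finset.mem_product] at he'
      obtain ⟨τ, hτ⟩ := σ.exists_subarc (hT01 _ he'.1.1).1 he'.2.1 (hT01 _ he'.1.2).2
      exact ⟨τ, fun _ => hτ⟩
    · exact ⟨σ, fun h => absurd h he⟩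
  choose arc harc using hex
  refine ⟨E.image arc, (T.image σ.param).filter (· ∈ F), Finset.card_image_le.trans
    (hEcard.trans hTcard), (Finset.card_filter_le _ _).trans (Finset.card_image_le.trans hTcard),
    ?_, ?_, ?_, ?_, ?_, ?_⟩
  · intro τ hτ
    obtain ⟨e, he, rfl⟩ := Finset.mem_image.1 hτ
    rw [(harc e he).1]
    exact (Finset.mem_filter.1 he).2.2.2
  · intro τ hτ x hx
    obtain ⟨e, he, rfl⟩ := Finset.mem_image.1 hτ
    have hxF : x ∈ F := by
      have h := (arc e).endpoints_subset hx
      rw [(harc e he).1] at h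
      exact (Finset.mem_filter.1 he).2.2.2 h
    rw [(harc e he).2] at hx
    have he' := Finset.mem_product.1 (Finset.mem_filter.1 he).1
    rw [Finset.mem_coe, Finset.mem_filter, Finset.mem_image]
    refine ⟨?_, hxF⟩
    rcases hx with rfl | rfl
    exacts [⟨_, he'.1, rfl⟩, ⟨_, he'.2, rfl⟩]
  · intro x hx
    exact (Finset.mem_filter.1 hx).2
  · rintro τ hτ x ⟨hx, hxV⟩
    obtain ⟨e, he, rfl⟩ := Finset.mem_image.1 hτ
    rw [(harc e he).1] at hx
    rw [(harc e he).2]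
    obtain ⟨t, ht, rfl⟩ := hx
    obtain ⟨heT, -, hgap, -⟩ := Finset.mem_filter.1 he
    rw [Finset.mem_product] at heT
    have htT := hVT t ⟨(hT01 _ heT.1).1.trans ht.1, ht.2.trans (hT01 _ heT.2).2⟩ hxV
    rcases ht.1.eq_or_lt with h | h
    · left; rw [h]
    · rcases ht.2.eq_or_lt with h' | h'
      · right; rw [h']; rfl
      · exact absurd ⟨h, h'⟩ (hgap t htT)
  · intro τ hτ τ' hτ' hne x hx
    obtain ⟨e, he, rfl⟩ := Finset.mem_image.1 hτ
    obtain ⟨e', he', rfl⟩ := Finset.mem_image.1 hτ'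
    rw [(harc e he).1, (harc e' he').1] at hx
    rw [(harc e he).2, (harc e' he').2]
    obtain ⟨⟨t, ht, rfl⟩, ⟨t', ht', htt⟩⟩ := hx
    obtain ⟨heT, -, hgap, -⟩ := Finset.mem_filter.1 he
    obtain ⟨heT', -, hgap', -⟩ := Finset.mem_filter.1 he'
    rw [Finset.mem_product] at heT heT'
    have ht01 : t ∈ Set.Icc (0 : ℝ) 1 := ⟨(hT01 _ heT.1).1.trans ht.1, ht.2.trans (hT01 _ heT.2).2⟩
    have ht01' : t' ∈ Set.Icc (0 : ℝ) 1 :=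
      ⟨(hT01 _ heT'.1).1.trans ht'.1, ht'.2.trans (hT01 _ heT'.2).2⟩
    have key : t ∈ T ∧ t' ∈ T := by
      rcases σ.param_inj ht01' ht01 htt with h | h | h
      · subst h
        by_contra hc
        rw [and_self] at hc
        -- two gaps with a common interior point coincide
        have hlt : ∀ y ∈ T, y ≠ t' := fun y hy h => hc (h ▸ hy)
        have a1 := lt_of_le_of_ne ht.1 (hlt _ heT.1)
        have a2 := lt_of_le_of_ne ht.2 (hlt _ heT.2).symm
        have b1 := lt_of_le_of_ne ht'.1 (hlt _ heT'.1)
        have b2 := lt_of_le_of_ne ht'.2 (hlt _ heT'.2).symm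
        refine hne (congrArg arc (Prod.ext ?_ ?_))
        · by_contra hne
          rcases lt_or_gt_of_ne hne with h | h
          · exact hgap _ heT'.1 ⟨h, b1.trans a2⟩
          · exact hgap' _ heT.1 ⟨h, a1.trans b2⟩
        · by_contra hne
          rcases lt_or_gt_of_ne hne with h | h
          · exact hgap' _ heT.2 ⟨b1.trans a2, h⟩
          · exact hgap _ heT'.2 ⟨a1.trans b2, h⟩
      · rw [h.1, h.2]; exact ⟨h1T, h0T⟩
      · rw [h.1, h.2]; exact ⟨h0T, h1T⟩
    constructor
    · rcases ht.1.eq_or_lt with h | h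
      · left; rw [h]
      · rcases ht.2.eq_or_lt with h' | h'
        · right; rw [h']; rfl
        · exact absurd ⟨h, h'⟩ (hgap t key.1)
    · rw [← htt]
      rcases ht'.1.eq_or_lt with h | h
      · left; rw [h]
      · rcases ht'.2.eq_or_lt with h' | h'
        · right; rw [h']; rfl
        · exact absurd ⟨h, h'⟩ (hgap' t' key.2)
  · intro x hx
    have hxσ := hFσ hx
    rw [carrier_eq] at hxσ
    obtain ⟨t, ht, rfl⟩ := hxσ
    by_cases htT : t ∈ T
    · right
      rw [Finset.mem_coe, Finset.mem_filter, Finset.mem_image]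
      exact ⟨⟨t, htT, rfl⟩, hx⟩
    · left
      have ht0 : 0 < t := lt_of_le_of_ne ht.1 (fun h => htT (h ▸ h0T))
      have ht1 : t < 1 := lt_of_le_of_ne ht.2 (fun h => htT (h ▸ h1T))
      obtain ⟨a, ha, hamax⟩ := (T.filter (· < t)).exists_max_image id ⟨0, by simp [h0T, ht0]⟩
      obtain ⟨b, hb, hbmin⟩ := (T.filter (t < ·)).exists_min_image id ⟨1, by simp [h1T, ht1]⟩
      rw [Finset.mem_filter] at ha hb
      have hgap : ∀ y ∈ T, ¬ (a < y ∧ y < b) := by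
        rintro y hy ⟨hay, hyb⟩
        rcases lt_trichotomy y t with h | h | h
        · exact absurd (hamax y (by simp [hy, h])) (not_le.2 hay)
        · exact htT (h ▸ hy)
        · exact absurd (hbmin y (by simp [hy, h])) (not_le.2 hyb)
      have hab : a < b := ha.2.trans hb.2
      have ha0 := (hT01 a ha.1).1
      have hb1 := (hT01 b hb.1).2
      set G : Set ℝ := σ.param ⁻¹' F with hG
      have hGcl : IsClosed G := hF.preimage σ.continuous_param
      have hGint : ∀ u ∈ Set.Ioo a b, u ∈ G → u ∈ interior G := by
        intro u hu huG
        have huV : σ.param u ∉ V := fun h =>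
          hgap u (hVT u ⟨ha0.trans hu.1.le, hu.2.le.trans hb1⟩ h) hu
        have hcont : Filter.Tendsto σ.param (nhds u) (nhdsWithin (σ.param u) σ.carrier) := by
          refine tendsto_nhdsWithin_iff.2 ⟨σ.continuous_param.tendsto u, ?_⟩
          filter_upwards [isOpen_Ioo.mem_nhds hu] with v hv
          rw [carrier_eq]
          exact ⟨v, ⟨ha0.trans hv.1.le, hv.2.le.trans hb1⟩, rfl⟩
        exact mem_interior_iff_mem_nhds.2 (hcont (hloc _ huG huV))
      have hsub : Set.Ioo a b ⊆ interior G := by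
        refine isPreconnected_Ioo.subset_of_closure_inter_subset isOpen_interior
          ⟨t, ⟨ha.2, hb.2⟩, hGint t ⟨ha.2, hb.2⟩ hx⟩ ?_
        rintro u ⟨hu, hu'⟩
        exact hGint u hu' (closure_minimal interior_subset hGcl hu)
      have hIcc : Set.Icc a b ⊆ G := by
        rw [← closure_Ioo hab.ne]
        exact closure_minimal (hsub.trans interior_subset) hGcl
      have hemem : (a, b) ∈ E := by
        rw [hE, Finset.mem_filter, Finset.mem_product]
        exact ⟨⟨ha.1, hb.1⟩, hab, hgap, Set.image_subset_iff.2 hIcc⟩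
      refine Set.mem_biUnion (Finset.mem_coe.2 (Finset.mem_image_of_mem arc hemem)) ?_
      rw [(harc _ hemem).1]
      exact ⟨t, ⟨ha.2.le, hb.2.le⟩, rfl⟩

end CircularArc

/-- Closed subsets `F k` of arcs `σ k` that are relatively open, and pairwise disjoint, away from
finite sets `V k` of points form together with finitely many points a set that decomposes into
arcs and points, with size linear in the number of all these points. -/
theorem exists_circularDecomposition {ι : Type*} (s : Finset ι) (σ : ι → CircularArc)
    (F : ι → Set Plane) (V : ι → Finset Plane) (P : Finset Plane)
    (hFσ : ∀ k ∈ s, F k ⊆ (σ k).carrier) (hF : ∀ k ∈ s, IsClosed (F k))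
    (hloc : ∀ k ∈ s, ∀ x ∈ F k, x ∉ V k → F k ∈ nhdsWithin x (σ k).carrier)
    (hinter : ∀ k ∈ s, ∀ l ∈ s, k ≠ l → F k ∩ F l ⊆ V k) :
    ∃ d : CircularDecomposition ((⋃ k ∈ s, F k) ∪ (P : Set Plane)),
      d.size ≤ ∑ k ∈ s, (2 * (V k).card + 4) + P.card := by
  classical
  have hex : ∀ k, ∃ (A : Finset CircularArc) (Q : Finset Plane), k ∈ s →
      A.card ≤ (V k).card + 2 ∧ Q.card ≤ (V k).card + 2 ∧
      (∀ τ ∈ A, τ.carrier ⊆ F k) ∧ (∀ τ ∈ A, τ.endpoints ⊆ Q) ∧ (Q : Set Plane) ⊆ F k ∧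
      (∀ τ ∈ A, τ.carrier ∩ V k ⊆ τ.endpoints) ∧
      (∀ τ ∈ A, ∀ τ' ∈ A, τ ≠ τ' → τ.carrier ∩ τ'.carrier ⊆ τ.endpoints ∩ τ'.endpoints) ∧
      F k ⊆ (⋃ τ ∈ A, τ.carrier) ∪ Q := by
    intro k
    by_cases hk : k ∈ s
    · obtain ⟨A, Q, h⟩ := (σ k).exists_subdivision (V k) (hFσ k hk) (hF k hk) (hloc k hk)
      exact ⟨A, Q, fun _ => h⟩
    · exact ⟨∅, ∅, fun h => absurd h hk⟩
  choose A Q hAQ using hex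
  set X : Finset Plane := s.biUnion Q ∪ P with hX
  have hinter' : ∀ τ ∈ s.biUnion A, ∀ τ' ∈ s.biUnion A, τ ≠ τ' →
      τ.carrier ∩ τ'.carrier ⊆ τ.endpoints ∩ τ'.endpoints := by
    intro τ hτ τ' hτ' hne
    obtain ⟨k, hk, hτ⟩ := Finset.mem_biUnion.1 hτ
    obtain ⟨l, hl, hτ'⟩ := Finset.mem_biUnion.1 hτ'
    obtain ⟨-, -, h1, -, -, h2, h3, -⟩ := hAQ k hk
    by_cases hkl : k = l
    · subst hkl
      exact h3 τ hτ τ' hτ' hne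
    · obtain ⟨-, -, h1', -, -, h2', -⟩ := hAQ l hl
      rintro x ⟨hx, hx'⟩
      exact ⟨h2 τ hτ ⟨hx, hinter k hk l hl hkl ⟨h1 τ hτ hx, h1' τ' hτ' hx'⟩⟩,
        h2' τ' hτ' ⟨hx', hinter l hl k hk (Ne.symm hkl) ⟨h1' τ' hτ' hx', h1 τ hτ hx⟩⟩⟩
  let d : CircularDecomposition ((⋃ k ∈ s, F k) ∪ (P : Set Plane)) :=
    { arcs := s.biUnion A
      points := X.filter (fun p => ∀ τ ∈ s.biUnion A, p ∉ τ.carrier)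
      union_eq := by
        apply Set.Subset.antisymm
        · rintro x (hx | hx)
          · obtain ⟨τ, hτ, hx⟩ := Set.mem_iUnion₂.1 hx
            obtain ⟨k, hk, hτ⟩ := Finset.mem_biUnion.1 hτ
            exact Or.inl (Set.mem_biUnion hk ((hAQ k hk).2.2.1 τ hτ hx))
          · rcases Finset.mem_union.1 (Finset.mem_filter.1 hx).1 with h | h
            · obtain ⟨k, hk, hx⟩ := Finset.mem_biUnion.1 h
              exact Or.inl (Set.mem_biUnion hk ((hAQ k hk).2.2.2.2.1 hx))
            · exact Or.inr h
        · intro x hx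
          by_cases hxa : ∃ τ ∈ s.biUnion A, x ∈ τ.carrier
          · obtain ⟨τ, hτ, hx⟩ := hxa
            exact Or.inl (Set.mem_biUnion hτ hx)
          · push Not at hxa
            refine Or.inr (Finset.mem_coe.2 (Finset.mem_filter.2 ⟨?_, hxa⟩))
            rcases hx with hx | hx
            · obtain ⟨k, hk, hx⟩ := Set.mem_iUnion₂.1 hx
              rcases (hAQ k hk).2.2.2.2.2.2.2 hx with h | h
              · obtain ⟨τ, hτ, hx⟩ := Set.mem_iUnion₂.1 h
                exact absurd hx (hxa τ (Finset.mem_biUnion.2 ⟨k, hk, hτ⟩))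
              · exact Finset.mem_union_left _ (Finset.mem_biUnion.2 ⟨k, hk, h⟩)
            · exact Finset.mem_union_right _ hx
      inter_subset := hinter'
      points_off_arcs := fun p hp => (Finset.mem_filter.1 hp).2 }
  refine ⟨d, ?_⟩
  have hvert : d.vertices ⊆ (X : Set Plane) := by
    rintro x (⟨τ, hτ, τ', hτ', hne, hx⟩ | hx)
    · obtain ⟨k, hk, hτk⟩ := Finset.mem_biUnion.1 hτ
      refine Finset.mem_coe.2 (Finset.mem_union_left _ (Finset.mem_biUnion.2 ⟨k, hk, ?_⟩))
      exact (hAQ k hk).2.2.2.1 τ hτk (hinter' τ hτ τ' hτ' hne hx).1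
    · exact Finset.mem_coe.2 (Finset.mem_filter.1 hx).1
  have hv : d.vertices.ncard ≤ ∑ k ∈ s, ((V k).card + 2) + P.card := by
    refine (Set.ncard_le_ncard hvert X.finite_toSet).trans ?_
    rw [Set.ncard_coe_finset]
    refine (Finset.card_union_le _ _).trans (Nat.add_le_add_right ?_ _)
    exact Finset.card_biUnion_le.trans (Finset.sum_le_sum fun k hk => (hAQ k hk).2.1)
  have ha : d.arcs.card ≤ ∑ k ∈ s, ((V k).card + 2) :=
    Finset.card_biUnion_le.trans (Finset.sum_le_sum fun k hk => (hAQ k hk).1)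
  have hsum : ∑ k ∈ s, (2 * (V k).card + 4) =
      ∑ k ∈ s, ((V k).card + 2) + ∑ k ∈ s, ((V k).card + 2) := by
    rw [← Finset.sum_add_distrib]
    exact Finset.sum_congr rfl fun k _ => by ring
  rw [CircularDecomposition.size, hsum]
  omega

/-! ### Boundaries of neighbourhoods of small sets -/

theorem mem_add_unitDisk {R : Set Plane} {x : Plane} :
    x ∈ R + unitDisk ↔ ∃ q ∈ R, dist x q ≤ 1 := by
  simp only [Set.mem_add, unitDisk, mem_closedBall_zero_iff]
  constructor
  · rintro ⟨q, hq, d, hd, rfl⟩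
    exact ⟨q, hq, by simpa [dist_eq_norm] using hd⟩
  · rintro ⟨q, hq, h⟩
    exact ⟨q, hq, x - q, by rwa [← dist_eq_norm], by abel⟩

theorem isCompact_add_unitDisk {R : Set Plane} (hR : IsCompact R) : IsCompact (R + unitDisk) :=
  hR.add (isCompact_closedBall 0 1)

theorem mem_interior_add_unitDisk {R : Set Plane} {x q : Plane} (hq : q ∈ R)
    (h : dist x q < 1) : x ∈ interior (R + unitDisk) := by
  refine mem_interior.2 ⟨Metric.ball q 1, fun y hy => ?_, Metric.isOpen_ball, h⟩
  exact mem_add_unitDisk.2 ⟨q, hq, (Metric.mem_ball.1 hy).le⟩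

theorem one_le_dist_of_mem_frontier {R : Set Plane} {p q : Plane}
    (hp : p ∈ frontier (R + unitDisk)) (hq : q ∈ R) : 1 ≤ dist p q := by
  by_contra! h
  exact hp.2 (mem_interior_add_unitDisk hq h)

theorem exists_dist_eq_one_of_mem_frontier {R : Set Plane} (hR : IsCompact R) {p : Plane}
    (hp : p ∈ frontier (R + unitDisk)) : ∃ q ∈ R, dist p q = 1 := by
  obtain ⟨q, hq, h⟩ := mem_add_unitDisk.1 ((isCompact_add_unitDisk hR).isClosed.frontier_subset hp)
  exact ⟨q, hq, h.antisymm (one_le_dist_of_mem_frontier hp hq)⟩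

theorem IsPreconnected.inter_frontier_nonempty_of_mem_interior {X : Type*}
    [TopologicalSpace X] {t s : Set X}
    (ht : IsPreconnected t) {x y : X} (hx : x ∈ t) (hxs : x ∈ interior s) (hy : y ∈ t)
    (hys : y ∉ closure s) : (t ∩ frontier s).Nonempty := by
  by_contra hne
  rw [Set.not_nonempty_iff_eq_empty] at hne
  have hcov : t ⊆ interior s ∪ (closure s)ᶜ := by
    intro z hz
    by_contra hc
    rw [Set.mem_union, not_or, Set.notMem_compl_iff] at hc
    exact (Set.ext_iff.1 hne z).1 ⟨hz, hc.2, hc.1⟩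
  obtain ⟨z, -, hz1, hz2⟩ := ht _ _ isOpen_interior isClosed_closure.isOpen_compl hcov
    ⟨x, hx, hxs⟩ ⟨y, hy, hys⟩
  exact hz2 (subset_closure (interior_subset hz1))

section SmallSet

variable {R : Set Plane} {a : Plane}

/-- Along the ray from `a` through `p` the distance to each point of `R` grows at `p`. -/
theorem inner_sub_sub_pos (hRa : ∀ q ∈ R, ‖q - a‖ ≤ 71 / 500) {p q : Plane} (hq : q ∈ R)
    (hpq : 1 ≤ dist p q) : 0 < inner ℝ (p - a) (p - q) := by
  have h1 : p - a = (p - q) + (q - a) := by abel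
  rw [dist_eq_norm] at hpq
  have h2 := abs_le.1 (abs_real_inner_le_norm (q - a) (p - q))
  have h3 := hRa q hq
  rw [h1, inner_add_left, real_inner_self_eq_norm_sq]
  nlinarith

/-- Moving from a boundary point towards the centre leads into the interior. -/
theorem sub_smul_mem_interior (hR : IsCompact R) (hRa : ∀ q ∈ R, ‖q - a‖ ≤ 71 / 500) {p : Plane}
    (hp : p ∈ frontier (R + unitDisk)) {δ : ℝ} (hδ : 0 < δ) (hδ1 : δ ≤ 1) :
    p - δ • (p - a) ∈ interior (R + unitDisk) := by
  obtain ⟨q, hq, hpq⟩ := exists_dist_eq_one_of_mem_frontier hR hp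
  refine mem_interior_add_unitDisk hq ?_
  rw [dist_eq_norm] at hpq ⊢
  have h1 : p - δ • (p - a) - q = (1 - δ) • (p - q) + (-δ) • (q - a) := by module
  have h2 := norm_add_le ((1 - δ) • (p - q)) ((-δ) • (q - a))
  rw [norm_smul, norm_smul, hpq, Real.norm_eq_abs, Real.norm_eq_abs, abs_neg, abs_of_pos hδ,
    abs_of_nonneg (by linarith : 0 ≤ 1 - δ)] at h2
  have h3 := hRa q hq
  rw [h1]
  nlinarith

/-- Moving from a boundary point away from the centre leads out of the set. -/
theorem add_smul_notMem (hRa : ∀ q ∈ R, ‖q - a‖ ≤ 71 / 500) {p : Plane}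
    (hp : p ∈ frontier (R + unitDisk)) {δ : ℝ} (hδ : 0 < δ) :
    p + δ • (p - a) ∉ R + unitDisk := by
  intro hmem
  obtain ⟨q, hq, h⟩ := mem_add_unitDisk.1 hmem
  have h1 := one_le_dist_of_mem_frontier hp hq
  have h2 := inner_sub_sub_pos hRa hq h1
  have h3 : p + δ • (p - a) - q = (p - q) + δ • (p - a) := by abel
  rw [dist_eq_norm] at h h1
  have h4 : ‖p + δ • (p - a) - q‖ ^ 2 ≤ 1 := by
    nlinarith [norm_nonneg (p + δ • (p - a) - q)]
  rw [h3, norm_add_sq_real, real_inner_smul_right, real_inner_comm] at h4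
  nlinarith [mul_pos hδ h2, sq_nonneg ‖δ • (p - a)‖]

/-- Near a boundary point the boundary meets every line in radial direction, at a short distance
along the line. -/
theorem eventually_exists_mem_frontier (hR : IsCompact R) (hRa : ∀ q ∈ R, ‖q - a‖ ≤ 71 / 500)
    {p : Plane} (hp : p ∈ frontier (R + unitDisk)) {η : ℝ} (hη : 0 < η) :
    ∀ᶠ y in nhds p, ∃ t : ℝ, |t| ≤ η ∧ y + t • (p - a) ∈ frontier (R + unitDisk) := by
  set δ := min η 1 with hδ
  have hδ0 : 0 < δ := lt_min hη one_pos
  have hin := isOpen_interior.mem_nhds (sub_smul_mem_interior hR hRa hp hδ0 (min_le_right _ _))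
  have hout := (isCompact_add_unitDisk hR).isClosed.isOpen_compl.mem_nhds
    (add_smul_notMem hRa hp hδ0)
  have hc1 : Filter.Tendsto (fun y => y - δ • (p - a)) (nhds p) (nhds (p - δ • (p - a))) :=
    (continuous_id.sub continuous_const).tendsto p
  have hc2 : Filter.Tendsto (fun y => y + δ • (p - a)) (nhds p) (nhds (p + δ • (p - a))) :=
    (continuous_id.add continuous_const).tendsto p
  filter_upwards [hc1 hin, hc2 hout] with y hy1 hy2
  have hpre : IsPreconnected ((fun t : ℝ => y + t • (p - a)) '' Set.Icc (-δ) δ) :=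
    isPreconnected_Icc.image _ (by fun_prop)
  obtain ⟨z, ⟨t, ht, rfl⟩, hz⟩ := hpre.inter_frontier_nonempty_of_mem_interior (s := R + unitDisk)
    (x := y - δ • (p - a)) (y := y + δ • (p - a))
    ⟨-δ, by constructor <;> linarith, by dsimp only; module⟩ hy1
    ⟨δ, by constructor <;> linarith, rfl⟩
    (by rw [(isCompact_add_unitDisk hR).isClosed.closure_eq]; exact hy2)
  exact ⟨t, (abs_le.2 ht).trans (min_le_left _ _), hz⟩

theorem le_norm_sub_center (hR : IsCompact R) (hRa : ∀ q ∈ R, ‖q - a‖ ≤ 71 / 500) {p : Plane}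
    (hp : p ∈ frontier (R + unitDisk)) : 429 / 500 ≤ ‖p - a‖ := by
  obtain ⟨q, hq, hpq⟩ := exists_dist_eq_one_of_mem_frontier hR hp
  have h := norm_sub_le_norm_sub_add_norm_sub p a q
  rw [dist_eq_norm] at hpq
  have := hRa q hq
  rw [norm_sub_rev a q] at h
  linarith

theorem norm_sub_center_le (hR : IsCompact R) (hRa : ∀ q ∈ R, ‖q - a‖ ≤ 71 / 500) {p : Plane}
    (hp : p ∈ frontier (R + unitDisk)) : ‖p - a‖ ≤ 571 / 500 := by
  obtain ⟨q, hq, hpq⟩ := exists_dist_eq_one_of_mem_frontier hR hp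
  have h := norm_sub_le_norm_sub_add_norm_sub p q a
  rw [dist_eq_norm] at hpq
  have := hRa q hq
  linarith

/-- A nonzero vector orthogonal to `u` that makes an obtuse angle with a given vector `n` orthogonal
to `u`. -/
theorem exists_orthogonal {u n : Plane} (hu : u ≠ 0) (hn : inner ℝ n u = 0) :
    ∃ v : Plane, v ≠ 0 ∧ inner ℝ v u = 0 ∧ (n ≠ 0 → inner ℝ v n < 0) := by
  by_cases h : n = 0
  · refine ⟨!₂[-u 1, u 0], ?_, ?_, fun h' => absurd h h'⟩
    · intro h0
      apply hu
      have e0 := congrArg (fun x : Plane => x 0) h0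
      have e1 := congrArg (fun x : Plane => x 1) h0
      simp at e0 e1
      exact plane_ext (by simpa using e1) (by simpa using e0)
    · simp [PiLp.inner_apply, Fin.sum_univ_two]; ring
  · have hpos : 0 < inner ℝ n n := real_inner_self_pos.2 h
    refine ⟨-n, neg_ne_zero.2 h, by simp [hn], fun _ => ?_⟩
    rw [inner_neg_left]; linarith

theorem eventually_exists_mem_frontier_inter (hR : IsCompact R)
    (hRa : ∀ q ∈ R, ‖q - a‖ ≤ 71 / 500) {p : Plane} (hp : p ∈ frontier (R + unitDisk))
    {η : ℝ} (hη : 0 < η) {U : Set Plane} (hU : U ∈ nhds p) :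
    ∀ᶠ y in nhds p, ∃ t : ℝ, |t| ≤ η ∧ y + t • (p - a) ∈ frontier (R + unitDisk) ∩ U := by
  have hcont : Filter.Tendsto (fun yt : Plane × ℝ => yt.1 + yt.2 • (p - a)) (nhds (p, 0))
      (nhds p) := by
    have : Continuous (fun yt : Plane × ℝ => yt.1 + yt.2 • (p - a)) := by fun_prop
    simpa using this.tendsto (p, 0)
  obtain ⟨e, he, hball⟩ := Metric.mem_nhds_iff.1 (hcont hU)
  filter_upwards [eventually_exists_mem_frontier hR hRa hp (lt_min hη (half_pos he)),
    Metric.ball_mem_nhds p he] with y ⟨t, ht, htf⟩ hy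
  have hmem : (y, t) ∈ Metric.ball (p, (0 : ℝ)) e := by
    rw [Metric.mem_ball, Prod.dist_eq, max_lt_iff, Real.dist_eq, sub_zero]
    exact ⟨hy, (ht.trans (min_le_right _ _)).trans_lt (half_lt_self he)⟩
  exact ⟨t, ht.trans (min_le_left _ _), htf, hball hmem⟩

/-- The boundary has points arbitrarily close to a boundary point `p` on each side of the radial
line through `p`. -/
theorem exists_mem_frontier_side (hR : IsCompact R) (hRa : ∀ q ∈ R, ‖q - a‖ ≤ 71 / 500)
    {p : Plane} (hp : p ∈ frontier (R + unitDisk)) (v : Plane) {U : Set Plane} (hU : U ∈ nhds p) :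
    ∃ s t : ℝ, 0 < s ∧ p + s • v + t • (p - a) ∈ frontier (R + unitDisk) ∩ U := by
  have hev := eventually_exists_mem_frontier_inter hR hRa hp one_pos hU
  have hcs : Filter.Tendsto (fun s : ℝ => p + s • v) (nhdsWithin 0 (Set.Ioi 0)) (nhds p) := by
    have : Continuous (fun s : ℝ => p + s • v) := by fun_prop
    have h := this.tendsto 0
    simp only [zero_smul, add_zero] at h
    exact h.mono_left nhdsWithin_le_nhds
  obtain ⟨s, ⟨t, -, htf⟩, hs⟩ := ((hcs.eventually hev).and self_mem_nhdsWithin).exists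
  exact ⟨s, t, hs, htf⟩

theorem sub_center_ne_zero (hR : IsCompact R) (hRa : ∀ q ∈ R, ‖q - a‖ ≤ 71 / 500) {p : Plane}
    (hp : p ∈ frontier (R + unitDisk)) : p - a ≠ 0 := by
  have := le_norm_sub_center hR hRa hp
  exact norm_pos_iff.1 (by linarith)

/-- The boundary has no isolated points. -/
theorem exists_mem_frontier_ne (hR : IsCompact R) (hRa : ∀ q ∈ R, ‖q - a‖ ≤ 71 / 500)
    {p : Plane} (hp : p ∈ frontier (R + unitDisk)) {U : Set Plane} (hU : U ∈ nhds p) :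
    ∃ z ∈ frontier (R + unitDisk) ∩ U, z ≠ p := by
  obtain ⟨v, hv, hvu, -⟩ := exists_orthogonal (n := 0) (sub_center_ne_zero hR hRa hp) (by simp)
  obtain ⟨s, t, hs, hz⟩ := exists_mem_frontier_side hR hRa hp v hU
  refine ⟨_, hz, fun h => ?_⟩
  have h2 : s • v + t • (p - a) = 0 := by
    have : p + (s • v + t • (p - a)) = p + 0 := by rw [← add_assoc, h, add_zero]
    exact add_left_cancel this
  have h3 := congrArg (fun x => inner ℝ v x) h2
  simp only [inner_add_right, real_inner_smul_right, hvu, mul_zero, add_zero,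
    inner_zero_right] at h3
  exact (mul_pos hs (real_inner_self_pos.2 hv)).ne' h3

/-- Near a point `p`, two different points of the boundary never differ by a vector whose direction
is close to the radial direction at `p`. Within distance `1/10` of `p` the outward unit normals
`x - q` of touching disks differ from `p - a` by at most `1/10 + 71/500 = 121/500`, which is less
than `19/50` by more than half the largest possible distance `1/5` of two such points. -/
theorem frontier_injOn_direction (hR : IsCompact R) (hRa : ∀ q ∈ R, ‖q - a‖ ≤ 71 / 500)
    {p w : Plane} (hw : ‖w‖ = 1) (hpw : 19 / 50 ≤ |inner ℝ w (p - a)|)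
    {x y : Plane} (hx : x ∈ frontier (R + unitDisk)) (hy : y ∈ frontier (R + unitDisk))
    (hxp : dist x p ≤ 1 / 10) (hyp : dist y p ≤ 1 / 10) {t : ℝ} (hxy : y = x + t • w) :
    y = x := by
  -- the unit disks touching the boundary at `x` and `y` keep the other point out
  have aux : ∀ x y : Plane, ∀ t : ℝ, x ∈ frontier (R + unitDisk) → y ∈ frontier (R + unitDisk) →
      dist x p ≤ 1 / 10 → y = x + t • w →
      ∃ e : ℝ, |e| ≤ 121 / 500 ∧ 0 ≤ t ^ 2 + 2 * t * (inner ℝ w (p - a) + e) := by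
    intro x y t hx hy hxp hxy
    obtain ⟨q, hq, hxq⟩ := exists_dist_eq_one_of_mem_frontier hR hx
    have hyq := one_le_dist_of_mem_frontier hy hq
    refine ⟨inner ℝ w ((x - p) - (q - a)), ?_, ?_⟩
    · refine (abs_real_inner_le_norm _ _).trans ?_
      rw [hw, one_mul]
      refine (norm_sub_le _ _).trans ?_
      have := hRa q hq
      rw [dist_eq_norm] at hxp
      linarith
    · have e1 : p - a + ((x - p) - (q - a)) = x - q := by abel
      rw [← inner_add_right, e1]
      rw [dist_eq_norm] at hyq hxq
      have e2 : y - q = (x - q) + t • w := by rw [hxy]; abel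
      have h3 : 1 ≤ ‖y - q‖ ^ 2 := by nlinarith
      rw [e2, norm_add_sq_real, norm_smul, hw, hxq, mul_one, Real.norm_eq_abs, sq_abs,
        real_inner_smul_right, real_inner_comm] at h3
      linarith
  obtain ⟨e, he, h1⟩ := aux x y t hx hy hxp hxy
  obtain ⟨f, hf, h2⟩ := aux y x (-t) hy hx hyp (by rw [hxy]; module)
  have ht : |t| ≤ 1 / 5 := by
    have h := dist_triangle_right y x p
    rw [hxy, dist_self_add_left, norm_smul, hw, mul_one, Real.norm_eq_abs, ← hxy] at h
    linarith
  have ht0 : t = 0 := by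
    rw [abs_le] at ht he hf
    by_contra hne
    rcases le_abs'.1 hpw with hW | hW <;> rcases lt_or_gt_of_ne hne with h | h <;> nlinarith
  rw [hxy, ht0, zero_smul, add_zero]

end SmallSet

/-! ### Neighbourhoods of circular domains are circular domains -/

section SmallSet

variable {R : Set Plane} {a : Plane}

/-- If the boundary is contained in a line or circle near `p`, it fills that line or circle
near `p`. -/
theorem frontier_mem_nhdsWithin_curve (hR : IsCompact R) (hRa : ∀ q ∈ R, ‖q - a‖ ≤ 71 / 500)
    {p : Plane} (hp : p ∈ frontier (R + unitDisk)) (σ : CircularArc)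
    (h : ∀ᶠ z in nhds p, z ∈ frontier (R + unitDisk) → z ∈ σ.curve) :
    frontier (R + unitDisk) ∈ nhdsWithin p σ.curve := by
  have hpσ : p ∈ σ.curve := h.self_of_nhds hp
  have hu := sub_center_ne_zero hR hRa hp
  cases σ with
  | segment b c hbc =>
    have hdiff : ∀ x ∈ (line[ℝ, b, c] : AffineSubspace ℝ Plane), ∀ y ∈ line[ℝ, b, c],
        ∃ s : ℝ, x - y = s • (c - b) := by
      intro x hx y hy
      obtain ⟨s, rfl⟩ := mem_affineSpan_pair_iff_exists_lineMap_eq.1 hx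
      obtain ⟨t, rfl⟩ := mem_affineSpan_pair_iff_exists_lineMap_eq.1 hy
      refine ⟨s - t, ?_⟩
      simp only [AffineMap.lineMap_apply, vsub_eq_sub, vadd_eq_add]
      module
    -- the line is not radial
    have hnr : ∀ s : ℝ, p - a ≠ s • (c - b) := by
      intro s hs
      obtain ⟨v, hv, hvu, -⟩ := exists_orthogonal (n := 0) hu (by simp)
      obtain ⟨x, t, hx, hz, hzU⟩ := exists_mem_frontier_side hR hRa hp v h
      obtain ⟨m, hm⟩ := hdiff _ (hzU hz) _ hpσ
      have hs0 : s ≠ 0 := by rintro rfl; exact hu (by simpa using hs)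
      have hvc : inner ℝ v (c - b) = 0 := by
        rw [hs, real_inner_smul_right] at hvu
        exact (mul_eq_zero.1 hvu).resolve_left hs0
      have e : p + x • v + t • (p - a) - p = x • v + t • (p - a) := by abel
      rw [e] at hm
      have h3 := congrArg (fun x => inner ℝ v x) hm
      simp only [inner_add_right, real_inner_smul_right, hvu, hvc, mul_zero, add_zero] at h3
      exact (mul_pos hx (real_inner_self_pos.2 hv)).ne' h3
    refine mem_nhdsWithin_iff_eventually.2 ?_
    filter_upwards [eventually_exists_mem_frontier_inter hR hRa hp one_pos h]
      with y ⟨t, _, hz, hzU⟩ hy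
    obtain ⟨m, hm⟩ := hdiff _ (hzU hz) _ hy
    rw [add_sub_cancel_left] at hm
    by_cases ht : t = 0
    · simpa [ht] using hz
    · refine absurd ?_ (hnr (t⁻¹ * m))
      rw [mul_smul, ← hm, inv_smul_smul₀ ht]
  | arc c ρ θ φ hρ hφ hφ' =>
    have hexp : ∀ x ∈ Metric.sphere c ρ, ∀ w, x + w ∈ Metric.sphere c ρ →
        2 * inner ℝ (x - c) w + ‖w‖ ^ 2 = 0 := by
      intro x hx w hw
      rw [mem_sphere_iff_norm] at hx hw
      have e : x + w - c = (x - c) + w := by abel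
      have := norm_add_sq_real (x - c) w
      rw [← e, hw, hx] at this
      linarith
    -- the circle is not tangent to the radial direction
    have hnr : inner ℝ (p - c) (p - a) ≠ 0 := by
      intro h0
      have hn : c - p ≠ 0 := by
        intro h1
        have h2 : dist p c = ρ := hpσ
        rw [sub_eq_zero.1 h1, dist_self] at h2
        exact hρ.ne h2
      obtain ⟨v, hv, hvu, hvn⟩ := exists_orthogonal (n := c - p) hu
        (by rw [← neg_sub, inner_neg_left, h0, neg_zero])
      obtain ⟨x, t, hx, hz, hzU⟩ := exists_mem_frontier_side hR hRa hp v h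
      have h1 := hexp p hpσ (x • v + t • (p - a)) (by rw [← add_assoc]; exact hzU hz)
      rw [inner_add_right, real_inner_smul_right, real_inner_smul_right, h0] at h1
      have h2 := hvn hn
      rw [← neg_sub, inner_neg_right, real_inner_comm] at h2
      nlinarith [sq_nonneg ‖x • v + t • (p - a)‖]
    set β := |inner ℝ (p - c) (p - a)| with hβ
    have hβ0 : 0 < β := abs_pos.2 hnr
    have hη : 0 < β / (‖p - a‖ ^ 2 + 1) := by positivity
    have hlim : ∀ᶠ y in nhds p, β / 2 < |inner ℝ (y - c) (p - a)| := by
      have hc : Continuous (fun y : Plane => |inner ℝ (y - c) (p - a)|) := by fun_prop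
      exact (hc.tendsto p).eventually (lt_mem_nhds (half_lt_self hβ0))
    refine mem_nhdsWithin_iff_eventually.2 ?_
    filter_upwards [eventually_exists_mem_frontier_inter hR hRa hp hη h, hlim]
      with y ⟨t, ht, hz, hzU⟩ hy hyc
    have h1 := hexp y hyc _ (hzU hz)
    rw [real_inner_smul_right, norm_smul, mul_pow, Real.norm_eq_abs, sq_abs] at h1
    by_cases ht0 : t = 0
    · simpa [ht0] using hz
    · exfalso
      have h2 : 2 * inner ℝ (y - c) (p - a) = - (t * ‖p - a‖ ^ 2) := by
        refine mul_left_cancel₀ ht0 ?_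
        linear_combination h1
      have h3 : 2 * |inner ℝ (y - c) (p - a)| = |t| * ‖p - a‖ ^ 2 := by
        have := congrArg abs h2
        rwa [abs_mul, abs_neg, abs_mul, abs_two, abs_of_nonneg (sq_nonneg ‖p - a‖)] at this
      rw [le_div_iff₀ (by positivity)] at ht
      nlinarith [abs_nonneg t]

end SmallSet

namespace CircularArc

theorem exists_curve_eq_sphere (c : Plane) {ρ : ℝ} (hρ : 0 < ρ) :
    ∃ κ : CircularArc, κ.curve = Metric.sphere c ρ :=
  ⟨.arc c ρ 0 (2 * Real.pi) hρ Real.two_pi_pos le_rfl, rfl⟩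

theorem isClosed_curve (σ : CircularArc) : IsClosed σ.curve := by
  cases σ with
  | segment a b hab => exact AffineSubspace.closed_of_finiteDimensional _
  | arc c ρ θ φ hρ hφ hφ' => exact Metric.isClosed_sphere

/-- The points at distance one from a segment, realised at an interior point of the segment, lie on
two parallel lines. -/
theorem exists_offset_segment {a b : Plane} (hab : a ≠ b) :
    ∃ n : Plane, ∀ p : Plane, ∀ t ∈ Set.Ioo (0 : ℝ) 1, dist p (AffineMap.lineMap a b t) = 1 →
      (∀ s ∈ Set.Icc (0 : ℝ) 1, 1 ≤ dist p (AffineMap.lineMap a b s)) →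
      p ∈ line[ℝ, a + n, b + n] ∨ p ∈ line[ℝ, a - n, b - n] := by
  set d := b - a with hd
  have hL : 0 < ‖d‖ := norm_pos_iff.2 (sub_ne_zero.2 hab.symm)
  refine ⟨!₂[-(d 1) / ‖d‖, d 0 / ‖d‖], fun p t ht hpt hmin => ?_⟩
  set n : Plane := !₂[-(d 1) / ‖d‖, d 0 / ‖d‖] with hn
  set w := p - AffineMap.lineMap a b t with hw
  have hw1 : ‖w‖ = 1 := by rw [hw, ← dist_eq_norm]; exact hpt
  have hquad : ∀ h : ℝ, t + h ∈ Set.Icc (0 : ℝ) 1 → 0 ≤ h * (h * ‖d‖ ^ 2 - 2 * inner ℝ w d) := by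
    intro h hh
    have h1 := hmin _ hh
    have e : p - AffineMap.lineMap a b (t + h) = w - h • d := by
      simp only [hw, hd, AffineMap.lineMap_apply, vsub_eq_sub, vadd_eq_add]
      module
    rw [dist_eq_norm, e] at h1
    have h2 : 1 ≤ ‖w - h • d‖ ^ 2 := by nlinarith
    rw [norm_sub_sq_real, hw1, real_inner_smul_right, norm_smul, mul_pow, Real.norm_eq_abs,
      sq_abs] at h2
    linarith
  have hort : inner ℝ w d = 0 := by
    have hmin' : IsLocalMin (fun h : ℝ => h * (h * ‖d‖ ^ 2 - 2 * inner ℝ w d)) 0 := by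
      have : Set.Ioo (-t) (1 - t) ∈ nhds (0 : ℝ) :=
        Ioo_mem_nhds (by linarith [ht.1]) (by linarith [ht.2])
      filter_upwards [this] with h hh
      rw [zero_mul]
      exact hquad h ⟨by linarith [hh.1], by linarith [hh.2]⟩
    have hder : HasDerivAt (fun h : ℝ => h * (h * ‖d‖ ^ 2 - 2 * inner ℝ w d))
        (1 * (0 * ‖d‖ ^ 2 - 2 * inner ℝ w d) + 0 * (1 * ‖d‖ ^ 2)) 0 :=
      (hasDerivAt_id' 0).mul (((hasDerivAt_id' 0).mul_const _).sub_const _)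
    have := hmin'.hasDerivAt_eq_zero hder
    linarith
  have hort' : w 0 * d 0 + w 1 * d 1 = 0 := by
    have := hort
    simp only [PiLp.inner_apply, Fin.sum_univ_two] at this
    simp at this
    linarith
  have hww : w 0 ^ 2 + w 1 ^ 2 = 1 := by rw [← plane_norm_sq, hw1, one_pow]
  have hdd := plane_norm_sq d
  -- the coordinate of `w` in the direction of the unit normal `n`
  set m := (w 1 * d 0 - w 0 * d 1) / ‖d‖ with hm
  have hm1 : m = 1 ∨ m = -1 := by
    rw [← sq_eq_one_iff, hm, div_pow, div_eq_one_iff_eq (by positivity), hdd]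
    linear_combination (d 0 ^ 2 + d 1 ^ 2) * hww - (w 0 * d 0 + w 1 * d 1) * hort'
  have hwn : w = m • n := by
    apply plane_ext
    · simp only [hm, hn, PiLp.smul_apply, smul_eq_mul]
      simp
      field_simp
      linear_combination w 0 * hdd + d 0 * hort'
    · simp only [hm, hn, PiLp.smul_apply, smul_eq_mul]
      simp
      field_simp
      linear_combination w 1 * hdd + d 1 * hort'
  have hp : p = AffineMap.lineMap a b t + w := by rw [hw]; abel
  rcases hm1 with h | h
  · left
    rw [h, one_smul] at hwn
    refine mem_affineSpan_pair_iff_exists_lineMap_eq.2 ⟨t, ?_⟩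
    rw [hp, hwn]
    simp only [AffineMap.lineMap_apply, vsub_eq_sub, vadd_eq_add]
    module
  · right
    rw [h] at hwn
    refine mem_affineSpan_pair_iff_exists_lineMap_eq.2 ⟨t, ?_⟩
    rw [hp, hwn]
    simp only [AffineMap.lineMap_apply, vsub_eq_sub, vadd_eq_add]
    module

/-- If the distance of `p` to an arc of a circle equals one and is realised at an interior point of
the arc, then `p` has distance `ρ + 1` or `|ρ - 1|` to the centre. -/
theorem dist_center_of_interior {c : Plane} {ρ θ φ : ℝ} (hρ : 0 < ρ) {p : Plane} {t : ℝ}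
    (ht : t ∈ Set.Ioo θ (θ + φ)) (hpt : dist p (circlePoint c ρ t) = 1)
    (hmin : ∀ s ∈ Set.Icc θ (θ + φ), 1 ≤ dist p (circlePoint c ρ s)) :
    dist p c = ρ + 1 ∨ dist p c = |ρ - 1| := by
  set X := p 0 - c 0 with hX
  set Y := p 1 - c 1 with hY
  have hd : ∀ s, dist p (circlePoint c ρ s) ^ 2 =
      X ^ 2 + Y ^ 2 + ρ ^ 2 - 2 * ρ * (X * Real.cos s + Y * Real.sin s) := by
    intro s
    rw [plane_dist_sq, circlePoint_apply_zero, circlePoint_apply_one]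
    linear_combination ρ ^ 2 * Real.sin_sq_add_cos_sq s
  have hmin' : IsLocalMax (fun s : ℝ => X * Real.cos s + Y * Real.sin s) t := by
    filter_upwards [Ioo_mem_nhds ht.1 ht.2] with s hs
    have h1 := hmin s ⟨hs.1.le, hs.2.le⟩
    have h2 : 1 ≤ dist p (circlePoint c ρ s) ^ 2 := by nlinarith
    have h3 := hd t
    rw [hpt] at h3
    rw [hd s] at h2
    nlinarith
  have hder := hmin'.hasDerivAt_eq_zero
    (((Real.hasDerivAt_cos t).const_mul X).add ((Real.hasDerivAt_sin t).const_mul Y))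
  have hsc := Real.sin_sq_add_cos_sq t
  set l := X * Real.cos t + Y * Real.sin t with hl
  have hXY : X ^ 2 + Y ^ 2 = l ^ 2 := by
    rw [hl]
    linear_combination (- (X ^ 2 + Y ^ 2)) * hsc +
      (X * -Real.sin t + Y * Real.cos t) * hder
  have hl1 : (l - ρ) ^ 2 = 1 := by
    have := hd t
    rw [hpt, hXY] at this
    linear_combination -this
  have hdl : dist p c = |l| := by
    rw [← Real.sqrt_sq_eq_abs, ← Real.sqrt_sq (dist_nonneg (x := p)), plane_dist_sq, ← hXY]
  rcases sq_eq_one_iff.1 hl1 with h | h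
  · left
    rw [hdl, abs_of_pos] <;> linarith
  · right
    rw [hdl]
    congr 1
    linarith

/-- The points whose distance to an arc equals one lie on finitely many lines and circles, up to
finitely many exceptions. -/
theorem exists_offset_curves (τ : CircularArc) :
    ∃ (κ : Finset CircularArc) (P : Finset Plane), ∀ p : Plane,
      (∃ q ∈ τ.carrier, dist p q = 1) → (∀ q ∈ τ.carrier, 1 ≤ dist p q) →
      p ∈ (⋃ σ ∈ κ, σ.curve) ∪ (P : Set Plane) := by
  classical
  obtain ⟨κ₀, h₀⟩ := exists_curve_eq_sphere (τ.param 0) one_pos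
  obtain ⟨κ₁, h₁⟩ := exists_curve_eq_sphere (τ.param 1) one_pos
  -- it remains to treat distances realised at interior points
  suffices hs : ∃ (κ : Finset CircularArc) (P : Finset Plane), ∀ p : Plane,
      (∃ t ∈ Set.Ioo (0 : ℝ) 1, dist p (τ.param t) = 1) → (∀ q ∈ τ.carrier, 1 ≤ dist p q) →
      p ∈ (⋃ σ ∈ κ, σ.curve) ∪ (P : Set Plane) by
    obtain ⟨κ, P, h⟩ := hs
    refine ⟨insert κ₀ (insert κ₁ κ), P, ?_⟩
    rintro p ⟨q, hq, hpq⟩ hmin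
    rw [carrier_eq] at hq
    obtain ⟨t, ht, rfl⟩ := hq
    rcases ht.1.eq_or_lt with h0 | h0
    · subst h0
      refine Or.inl (Set.mem_biUnion (Finset.mem_coe.2 (Finset.mem_insert_self _ _)) ?_)
      rw [h₀]; exact hpq
    · rcases ht.2.eq_or_lt with h1 | h1
      · subst h1
        refine Or.inl (Set.mem_biUnion (Finset.mem_coe.2
          (Finset.mem_insert_of_mem (Finset.mem_insert_self _ _))) ?_)
        rw [h₁]; exact hpq
      · rcases h p ⟨t, ⟨h0, h1⟩, hpq⟩ hmin with hp | hp
        · obtain ⟨σ, hσ, hp⟩ := Set.mem_iUnion₂.1 hp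
          exact Or.inl (Set.mem_biUnion (Finset.mem_coe.2
            (Finset.mem_insert_of_mem (Finset.mem_insert_of_mem hσ))) hp)
        · exact Or.inr hp
  cases τ with
  | segment a b hab =>
    obtain ⟨n, hn⟩ := exists_offset_segment hab
    refine ⟨{.segment (a + n) (b + n) (fun h => hab (add_right_cancel h)),
      .segment (a - n) (b - n) (fun h => hab (sub_left_injective h))}, ∅, ?_⟩
    rintro p ⟨t, ht, hpt⟩ hmin
    left
    rw [Finset.set_biUnion_insert, Finset.set_biUnion_singleton]
    refine hn p t ht hpt fun s hs => hmin _ ?_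
    rw [carrier_eq]
    exact ⟨s, hs, rfl⟩
  | arc c ρ θ φ hρ hφ hφ' =>
    obtain ⟨κ₂, h₂⟩ := exists_curve_eq_sphere c (by linarith : 0 < ρ + 1)
    have key : ∀ p : Plane,
        (∃ t ∈ Set.Ioo (0 : ℝ) 1, dist p ((arc c ρ θ φ hρ hφ hφ').param t) = 1) →
        (∀ q ∈ (arc c ρ θ φ hρ hφ hφ').carrier, 1 ≤ dist p q) →
        dist p c = ρ + 1 ∨ dist p c = |ρ - 1| := by
      rintro p ⟨t, ht, hpt⟩ hmin
      refine dist_center_of_interior hρ (t := θ + t * φ) (θ := θ) (φ := φ) ?_ hpt ?_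
      · constructor <;> nlinarith [ht.1, ht.2]
      · intro s hs
        exact hmin _ ⟨s, hs, rfl⟩
    by_cases hρ1 : ρ = 1
    · refine ⟨{κ₂}, {c}, fun p h1 h2 => ?_⟩
      rw [Finset.set_biUnion_singleton, h₂, Finset.coe_singleton]
      rcases key p h1 h2 with h | h
      · exact Or.inl h
      · right
        rw [hρ1, sub_self, abs_zero] at h
        exact dist_eq_zero.1 h
    · obtain ⟨κ₃, h₃⟩ := exists_curve_eq_sphere c (abs_pos.2 (sub_ne_zero.2 hρ1))
      refine ⟨{κ₂, κ₃}, ∅, fun p h1 h2 => ?_⟩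
      left
      rw [Finset.set_biUnion_insert, Finset.set_biUnion_singleton, h₂, h₃]
      exact key p h1 h2

end CircularArc

section SmallSet

variable {R : Set Plane} {a : Plane}

/-- The boundary of the neighbourhood lies on finitely many lines and circles, up to finitely many
points: a boundary point has distance one to the arc or point that carries its nearest point. -/
theorem frontier_subset_curves (hR : IsCompact R) (d : CircularDecomposition (frontier R)) :
    ∃ (κ : Finset CircularArc) (P : Finset Plane),
      frontier (R + unitDisk) ⊆ (⋃ σ ∈ κ, σ.curve) ∪ (P : Set Plane) := by
  classical
  choose κ P hκP using CircularArc.exists_offset_curves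
  choose c hc using fun q : Plane => CircularArc.exists_curve_eq_sphere q one_pos
  refine ⟨d.arcs.biUnion κ ∪ d.points.image c, d.arcs.biUnion P, fun p hp => ?_⟩
  obtain ⟨q, hq, hpq⟩ := exists_dist_eq_one_of_mem_frontier hR hp
  have hqf : q ∈ frontier R := by
    refine ⟨subset_closure hq, fun hint => ?_⟩
    -- an interior point of `R` is never nearest to a point outside
    obtain ⟨e, he, hball⟩ := Metric.mem_nhds_iff.1 (mem_interior_iff_mem_nhds.1 hint)
    set m := min (e / 2) (1 / 2) with hm
    have hm0 : 0 < m := lt_min (half_pos he) one_half_pos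
    have hm1 : m ≤ 1 / 2 := min_le_right _ _
    rw [dist_eq_norm] at hpq
    have hmem : q + m • (p - q) ∈ R := by
      refine hball (Metric.mem_ball.2 ?_)
      rw [dist_self_add_left, norm_smul, hpq, mul_one, Real.norm_eq_abs, abs_of_pos hm0]
      exact (min_le_left _ _).trans_lt (half_lt_self he)
    have h1 := one_le_dist_of_mem_frontier hp hmem
    have e1 : p - (q + m • (p - q)) = (1 - m) • (p - q) := by module
    rw [dist_eq_norm, e1, norm_smul, hpq, mul_one, Real.norm_eq_abs,
      abs_of_pos (by linarith)] at h1
    linarith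
  have hfR : frontier R ⊆ R := hR.isClosed.frontier_subset
  have hqd := hqf
  rw [← d.union_eq] at hqd
  rcases hqd with hqd | hqd
  · obtain ⟨τ, hτ, hqτ⟩ := Set.mem_iUnion₂.1 hqd
    have hτR : ∀ x ∈ τ.carrier, 1 ≤ dist p x := fun x hx =>
      one_le_dist_of_mem_frontier hp (hfR (by
        rw [← d.union_eq]; exact Or.inl (Set.mem_biUnion hτ hx)))
    rcases hκP τ p ⟨q, hqτ, hpq⟩ hτR with h | h
    · obtain ⟨σ, hσ, h⟩ := Set.mem_iUnion₂.1 h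
      exact Or.inl (Set.mem_biUnion (Finset.mem_coe.2
        (Finset.mem_union_left _ (Finset.mem_biUnion.2 ⟨τ, hτ, hσ⟩))) h)
    · exact Or.inr (Finset.mem_coe.2 (Finset.mem_biUnion.2 ⟨τ, hτ, h⟩))
  · refine Or.inl (Set.mem_biUnion (Finset.mem_coe.2
      (Finset.mem_union_right _ (Finset.mem_image_of_mem c hqd))) ?_)
    rw [hc]; exact hpq

theorem isCircularDomain_add_unitDisk (hR : IsCompact R) (hRa : ∀ q ∈ R, ‖q - a‖ ≤ 71 / 500)
    (hd : IsCircularDomain R) : IsCircularDomain (R + unitDisk) := by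
  classical
  have hS := isCompact_add_unitDisk hR
  refine ⟨hS.isClosed, ?_⟩
  obtain ⟨-, ⟨d⟩⟩ := hd
  obtain ⟨κ, P, hcov⟩ := frontier_subset_curves hR d
  set g := frontier (R + unitDisk) with hg
  have hgb : Bornology.IsBounded g := hS.isBounded.subset hS.isClosed.frontier_subset
  set s : Finset (Set Plane) := κ.image CircularArc.curve with hs
  have hrep : ∀ K : Set Plane, ∃ σ τ : CircularArc, K ∈ s →
      σ.curve = K ∧ τ.carrier ⊆ K ∧ K ∩ g ⊆ τ.carrier := by
    intro K
    by_cases hK : K ∈ s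
    · obtain ⟨σ, -, rfl⟩ := Finset.mem_image.1 hK
      obtain ⟨τ, h1, h2⟩ := σ.exists_arc_of_isBounded hgb
      exact ⟨σ, τ, fun _ => ⟨rfl, h1, h2⟩⟩
    · let σ : CircularArc := .arc 0 1 0 1 one_pos one_pos (by linarith [Real.pi_gt_three])
      exact ⟨σ, σ, fun h => absurd h hK⟩
  choose σ τ hστ using hrep
  -- cut each curve at its intersections with the other ones and at the exceptional points
  have hVfin : ∀ K, K ∈ s →
      ((⋃ L ∈ s.erase K, K ∩ L) ∪ (P : Set Plane)).Finite := by
    intro K hK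
    refine Set.Finite.union ((s.erase K).finite_toSet.biUnion fun L hL => ?_) P.finite_toSet
    obtain ⟨hLK, hL⟩ := Finset.mem_erase.1 hL
    have hne : (σ K).curve ≠ (σ L).curve := by
      rw [(hστ K hK).1, (hστ L hL).1]; exact hLK.symm
    obtain ⟨x, y, hxy⟩ := CircularArc.exists_inter_curve_subset_pair hne
    rw [(hστ K hK).1, (hστ L hL).1] at hxy
    exact (Set.toFinite {x, y}).subset hxy
  let V : Set Plane → Finset Plane := fun K => if h : K ∈ s then (hVfin K h).toFinset else ∅
  have hV : ∀ K ∈ s, ∀ x, x ∈ V K ↔ x ∈ (⋃ L ∈ s.erase K, K ∩ L) ∪ (P : Set Plane) := by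
    intro K hK x
    simp only [V, dif_pos hK, Set.Finite.mem_toFinset]
  obtain ⟨d', -⟩ := exists_circularDecomposition s τ (fun K => g ∩ K) V (P.filter (· ∈ g))
    (fun K hK => by rw [Set.inter_comm]; exact (hστ K hK).2.2)
    (fun K hK => by
      refine isClosed_frontier.inter ?_
      rw [← (hστ K hK).1]
      exact (σ K).isClosed_curve)
    (by
      rintro K hK x ⟨hxg, hxK⟩ hxV
      rw [hV K hK, Set.mem_union, not_or] at hxV
      have hother : ∀ᶠ z in nhds x, ∀ L ∈ s.erase K, z ∉ L := by
        rw [Filter.eventually_all_finset]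
        intro L hL
        have hL' := (Finset.mem_erase.1 hL).2
        have hcl : IsClosed L := by
          rw [← (hστ L hL').1]; exact (σ L).isClosed_curve
        exact hcl.isOpen_compl.mem_nhds fun hxL => hxV.1 (Set.mem_biUnion hL ⟨hxK, hxL⟩)
      have hPev : ∀ᶠ z in nhds x, z ∉ (P : Set Plane) :=
        P.finite_toSet.isClosed.isOpen_compl.mem_nhds hxV.2
      have hloc : g ∈ nhdsWithin x K := by
        have := frontier_mem_nhdsWithin_curve hR hRa hxg (σ K) (by
          filter_upwards [hother, hPev] with z hz hzP hzg
          rw [(hστ K hK).1]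
          rcases hcov hzg with h | h
          · obtain ⟨ρ, hρ, hzρ⟩ := Set.mem_iUnion₂.1 h
            by_contra hzK
            refine hz ρ.curve (Finset.mem_erase.2 ⟨?_, Finset.mem_image_of_mem _ hρ⟩) hzρ
            rintro rfl
            exact hzK hzρ
          · exact absurd h hzP)
        rwa [(hστ K hK).1] at this
      exact nhdsWithin_mono x (hστ K hK).2.1 (Filter.inter_mem hloc self_mem_nhdsWithin))
    (by
      rintro K hK L hL hKL x ⟨⟨-, hxK⟩, ⟨-, hxL⟩⟩
      rw [Finset.mem_coe, hV K hK]
      exact Or.inl (Set.mem_biUnion (Finset.mem_coe.2 (Finset.mem_erase.2 ⟨Ne.symm hKL, hL⟩))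
        ⟨hxK, hxL⟩))
  have heq : (⋃ K ∈ s, g ∩ K) ∪ ((P.filter (· ∈ g) : Finset Plane) : Set Plane) = g := by
    apply Set.Subset.antisymm
    · rintro x (hx | hx)
      · obtain ⟨K, -, hx⟩ := Set.mem_iUnion₂.1 hx
        exact hx.1
      · exact (Finset.mem_filter.1 hx).2
    · intro x hx
      rcases hcov hx with h | h
      · obtain ⟨ρ, hρ, hxρ⟩ := Set.mem_iUnion₂.1 h
        exact Or.inl (Set.mem_biUnion (Finset.mem_coe.2 (Finset.mem_image_of_mem _ hρ)) ⟨hx, hxρ⟩)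
      · exact Or.inr (Finset.mem_coe.2 (Finset.mem_filter.2 ⟨h, hx⟩))
  exact ⟨heq ▸ d'⟩

/-- Since the boundary has no isolated points, it is covered by the arcs of any decomposition. -/
theorem points_eq_empty (hR : IsCompact R) (hRa : ∀ q ∈ R, ‖q - a‖ ≤ 71 / 500)
    (d : CircularDecomposition (frontier (R + unitDisk))) : d.points = ∅ := by
  rw [Finset.eq_empty_iff_forall_notMem]
  intro p hp
  have hpf : p ∈ frontier (R + unitDisk) := by
    rw [← d.union_eq]; exact Or.inr hp
  have h1 : ∀ᶠ z in nhds p, ∀ σ ∈ d.arcs, z ∉ σ.carrier := by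
    rw [Filter.eventually_all_finset]
    intro σ hσ
    exact σ.isCompact_carrier.isClosed.isOpen_compl.mem_nhds (d.points_off_arcs p hp σ hσ)
  have h2 : ∀ᶠ z in nhds p, ∀ q ∈ d.points.erase p, z ≠ q := by
    rw [Filter.eventually_all_finset]
    intro q hq
    exact isOpen_ne.mem_nhds (Finset.mem_erase.1 hq).1.symm
  obtain ⟨z, ⟨hz, hz1, hz2⟩, hzp⟩ := exists_mem_frontier_ne hR hRa hpf (h1.and h2)
  rw [← d.union_eq] at hz
  rcases hz with hz | hz
  · obtain ⟨σ, hσ, hz⟩ := Set.mem_iUnion₂.1 hz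
    exact hz1 σ hσ hz
  · exact hz2 z (Finset.mem_erase.2 ⟨hzp, hz⟩) rfl

end SmallSet

/-! ### Pairs of meeting arcs of two boundaries -/

/-- Small connected sets `J j` with pairwise finite intersections, projected by a map that is
injective on their union near a point: at most two of them, one on each side, project onto a given
value. Hence a family of three projections and one value for each projection and each `i` lead to
at most six sets `J j` for each `i`. -/
theorem card_pairs_over_value_le {ι κ : Type*} (A : Finset ι) (B : Finset κ)
    (I : ι → Set Plane) (J : κ → Set Plane) (f : Fin 3 → Plane → ℝ) (hf : ∀ w, Continuous (f w))
    (v : ι → Fin 3 → ℝ)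
    (hI : ∀ i ∈ A, ∀ x ∈ I i, ∀ y ∈ I i, dist x y ≤ 1 / 20)
    (hJ : ∀ j ∈ B, ∀ x ∈ J j, ∀ y ∈ J j, dist x y ≤ 1 / 20)
    (hJc : ∀ j ∈ B, IsPreconnected (J j)) (hJn : ∀ j ∈ B, (J j).Nontrivial)
    (hJf : ∀ j ∈ B, ∀ j' ∈ B, j ≠ j' → (J j ∩ J j').Finite)
    (S : Finset (ι × κ)) (hS : ∀ x ∈ S, x.1 ∈ A ∧ x.2 ∈ B ∧ ∃ p ∈ I x.1 ∩ J x.2, ∃ w : Fin 3,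
      Set.InjOn (f w) ((⋃ j ∈ B, J j) ∩ Metric.closedBall p (1 / 10)) ∧
      ∃ t ∈ J x.2, f w t = v x.1 w) :
    S.card ≤ 6 * A.card := by
  classical
  -- `c` says on which side of the value the projection of `J j` extends
  have hex : ∀ x : ι × κ, ∃ c : Fin 3 × Bool, x ∈ S → ∃ p ∈ I x.1 ∩ J x.2,
      Set.InjOn (f c.1) ((⋃ j ∈ B, J j) ∩ Metric.closedBall p (1 / 10)) ∧
      ∃ t ∈ J x.2, f c.1 t = v x.1 c.1 ∧ ∃ y ∈ J x.2,
        (c.2 = true → v x.1 c.1 < f c.1 y) ∧ (c.2 = false → f c.1 y < v x.1 c.1) := by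
    intro x
    by_cases hx : x ∈ S
    · obtain ⟨hxA, hxB, p, hp, w, hinj, t, ht, htv⟩ := hS x hx
      have hne : ∃ y ∈ J x.2, f w y ≠ v x.1 w := by
        by_contra! hall
        obtain ⟨y, hy, z, hz, hyz⟩ := hJn _ hxB
        have hmem : ∀ y ∈ J x.2, y ∈ (⋃ j ∈ B, J j) ∩ Metric.closedBall p (1 / 10) :=
          fun y hy => ⟨Set.mem_biUnion hxB hy, (hJ _ hxB y hy p hp.2).trans (by norm_num)⟩
        exact hyz (hinj (hmem y hy) (hmem z hz) ((hall y hy).trans (hall z hz).symm))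
      obtain ⟨y, hy, hyv⟩ := hne
      rcases lt_or_gt_of_ne hyv with h | h
      · exact ⟨(w, false), fun _ => ⟨p, hp, hinj, t, ht, htv, y, hy, by simp, fun _ => h⟩⟩
      · exact ⟨(w, true), fun _ => ⟨p, hp, hinj, t, ht, htv, y, hy, fun _ => h, by simp⟩⟩
    · exact ⟨(0, true), fun h => absurd h hx⟩
  choose c hc using hex
  have hcard : S.card ≤ (A ×ˢ (Finset.univ : Finset (Fin 3 × Bool))).card := by
    refine Finset.card_le_card_of_injOn (fun x => (x.1, c x)) ?_ ?_
    · intro x hx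
      simpa using (hS x hx).1
    · rintro ⟨i, j⟩ hx ⟨i', j'⟩ hx' heq
      obtain ⟨rfl, hcc⟩ := Prod.ext_iff.1 heq
      simp only at hcc
      by_contra hne
      have hjj : j ≠ j' := fun h => hne (by rw [h])
      obtain ⟨hiA, hjB, -⟩ := hS _ hx
      obtain ⟨-, hjB', -⟩ := hS _ hx'
      obtain ⟨p, hp, hinj, t, ht, htv, y, hy, hyr, hyl⟩ := hc _ hx
      obtain ⟨p', hp', -, t', ht', htv', y', hy', hyr', hyl'⟩ := hc _ hx'
      rw [← hcc] at htv' hyr' hyl'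
      set w := (c (i, j)).1
      have hmem : ∀ z ∈ J j, z ∈ (⋃ j ∈ B, J j) ∩ Metric.closedBall p (1 / 10) :=
        fun z hz => ⟨Set.mem_biUnion hjB hz, (hJ _ hjB z hz p hp.2).trans (by norm_num)⟩
      have hmem' : ∀ z ∈ J j', z ∈ (⋃ j ∈ B, J j) ∩ Metric.closedBall p (1 / 10) := by
        refine fun z hz => ⟨Set.mem_biUnion hjB' hz, ?_⟩
        have h1 := hJ _ hjB' z hz p' hp'.2
        have h2 := hI i hiA p' hp'.1 p hp.1
        have h3 := dist_triangle z p' p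
        rw [Metric.mem_closedBall]
        linarith
      -- a nondegenerate interval of common values forces infinitely many common points
      have hfin : ∀ l u : ℝ, l < u → Set.Icc l u ⊆ f w '' J j → Set.Icc l u ⊆ f w '' J j' →
          False := by
        intro l u hlu h1 h2
        have hsub : Set.Icc l u ⊆ f w '' (J j ∩ J j') := by
          intro r hr
          obtain ⟨z, hz, hzr⟩ := h1 hr
          obtain ⟨z', hz', hzr'⟩ := h2 hr
          have := hinj (hmem z hz) (hmem' z' hz') (hzr.trans hzr'.symm)
          exact ⟨z, ⟨hz, this ▸ hz'⟩, hzr⟩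
        exact (Set.Icc_infinite hlu) (((hJf j hjB j' hjB' hjj).image _).subset hsub)
      have ho : Set.OrdConnected (f w '' J j) :=
        ((hJc j hjB).image _ (hf w).continuousOn).ordConnected
      have ho' : Set.OrdConnected (f w '' J j') :=
        ((hJc j' hjB').image _ (hf w).continuousOn).ordConnected
      have e1 : v i w ∈ f w '' J j := ⟨t, ht, htv⟩
      have e1' : v i w ∈ f w '' J j' := ⟨t', ht', htv'⟩
      have e2 : f w y ∈ f w '' J j := ⟨y, hy, rfl⟩
      have e2' : f w y' ∈ f w '' J j' := ⟨y', hy', rfl⟩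
      cases hb : (c (i, j)).2 with
      | true =>
        exact hfin _ (min (f w y) (f w y')) (lt_min (hyr hb) (hyr' hb))
          ((Set.Icc_subset_Icc_right (min_le_left _ _)).trans (ho.out e1 e2))
          ((Set.Icc_subset_Icc_right (min_le_right _ _)).trans (ho'.out e1' e2'))
      | false =>
        exact hfin (max (f w y) (f w y')) _ (max_lt (hyl hb) (hyl' hb))
          ((Set.Icc_subset_Icc_left (le_max_left _ _)).trans (ho.out e2 e1))
          ((Set.Icc_subset_Icc_left (le_max_right _ _)).trans (ho'.out e2' e1'))
  refine hcard.trans ?_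
  rw [Finset.card_product]
  simp [mul_comm]

/-- Two families of small connected sets, such that near each common point one of three projections
is injective on the union of each family, have at most linearly many intersecting pairs: the larger
one of the two left ends of the projections of an intersecting pair belongs to both projections. -/
theorem card_intersecting_pairs_le {ι κ : Type*} (A : Finset ι) (B : Finset κ)
    (I : ι → Set Plane) (J : κ → Set Plane) (f : Fin 3 → Plane → ℝ) (hf : ∀ w, Continuous (f w))
    (hI : ∀ i ∈ A, ∀ x ∈ I i, ∀ y ∈ I i, dist x y ≤ 1 / 20)
    (hJ : ∀ j ∈ B, ∀ x ∈ J j, ∀ y ∈ J j, dist x y ≤ 1 / 20)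
    (hIk : ∀ i ∈ A, IsCompact (I i)) (hJk : ∀ j ∈ B, IsCompact (J j))
    (hIc : ∀ i ∈ A, IsPreconnected (I i)) (hJc : ∀ j ∈ B, IsPreconnected (J j))
    (hIn : ∀ i ∈ A, (I i).Nontrivial) (hJn : ∀ j ∈ B, (J j).Nontrivial)
    (hIf : ∀ i ∈ A, ∀ i' ∈ A, i ≠ i' → (I i ∩ I i').Finite)
    (hJf : ∀ j ∈ B, ∀ j' ∈ B, j ≠ j' → (J j ∩ J j').Finite)
    (hinj : ∀ i ∈ A, ∀ j ∈ B, ∀ p ∈ I i ∩ J j, ∃ w,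
      Set.InjOn (f w) ((⋃ i ∈ A, I i) ∩ Metric.closedBall p (1 / 10)) ∧
      Set.InjOn (f w) ((⋃ j ∈ B, J j) ∩ Metric.closedBall p (1 / 10)))
    (S : Finset (ι × κ)) (hS : ∀ x ∈ S, x.1 ∈ A ∧ x.2 ∈ B ∧ (I x.1 ∩ J x.2).Nonempty) :
    S.card ≤ 6 * (A.card + B.card) := by
  classical
  have hmin : ∀ (K : Set Plane) (w : Fin 3), ∃ m : ℝ, IsCompact K → K.Nonempty →
      (∃ x ∈ K, f w x = m) ∧ ∀ y ∈ K, m ≤ f w y := by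
    intro K w
    by_cases h : IsCompact K ∧ K.Nonempty
    · obtain ⟨x, hx, hmin⟩ := h.1.exists_isMinOn h.2 (hf w).continuousOn
      exact ⟨f w x, fun _ _ => ⟨⟨x, hx, rfl⟩, fun y hy => hmin hy⟩⟩
    · exact ⟨0, fun h1 h2 => absurd ⟨h1, h2⟩ h⟩
  choose m hm using hmin
  set S₁ := S.filter fun x => ∃ p ∈ I x.1 ∩ J x.2, ∃ w : Fin 3,
      Set.InjOn (f w) ((⋃ j ∈ B, J j) ∩ Metric.closedBall p (1 / 10)) ∧
      ∃ t ∈ J x.2, f w t = m (I x.1) w with hS₁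
  set S₂ := S.filter fun x => ∃ p ∈ J x.2 ∩ I x.1, ∃ w : Fin 3,
      Set.InjOn (f w) ((⋃ i ∈ A, I i) ∩ Metric.closedBall p (1 / 10)) ∧
      ∃ t ∈ I x.1, f w t = m (J x.2) w with hS₂
  have h1 : S₁.card ≤ 6 * A.card := by
    refine card_pairs_over_value_le A B I J f hf (fun i => m (I i)) hI hJ hJc hJn hJf S₁ ?_
    intro x hx
    obtain ⟨hxS, h⟩ := Finset.mem_filter.1 hx
    exact ⟨(hS x hxS).1, (hS x hxS).2.1, h⟩
  have h2 : S₂.card ≤ 6 * B.card := by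
    rw [← Finset.card_image_of_injective S₂ Prod.swap_injective]
    refine card_pairs_over_value_le B A J I f hf (fun j => m (J j)) hJ hI hIc hIn hIf _ ?_
    intro x hx
    obtain ⟨y, hy, rfl⟩ := Finset.mem_image.1 hx
    obtain ⟨hyS, h⟩ := Finset.mem_filter.1 hy
    exact ⟨(hS y hyS).2.1, (hS y hyS).1, h⟩
  have hcov : S ⊆ S₁ ∪ S₂ := by
    intro x hx
    obtain ⟨hA, hB, p, hp⟩ := hS x hx
    obtain ⟨w, hw, hw'⟩ := hinj _ hA _ hB p hp
    obtain ⟨⟨y, hy, hym⟩, hmI⟩ := hm (I x.1) w (hIk _ hA) ⟨p, hp.1⟩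
    obtain ⟨⟨z, hz, hzm⟩, hmJ⟩ := hm (J x.2) w (hJk _ hB) ⟨p, hp.2⟩
    rcases le_total (m (J x.2) w) (m (I x.1) w) with h | h
    · refine Finset.mem_union_left _ (Finset.mem_filter.2 ⟨hx, p, hp, w, hw', ?_⟩)
      have ho := ((hJc _ hB).image _ (hf w).continuousOn).ordConnected
      exact ho.out ⟨z, hz, rfl⟩ ⟨p, hp.2, rfl⟩ ⟨hzm.trans_le h, hmI p hp.1⟩
    · refine Finset.mem_union_right _ (Finset.mem_filter.2 ⟨hx, p, hp.symm, w, hw, ?_⟩)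
      have ho := ((hIc _ hA).image _ (hf w).continuousOn).ordConnected
      exact ho.out ⟨y, hy, rfl⟩ ⟨p, hp.1, rfl⟩ ⟨hym.trans_le h, hmJ p hp.2⟩
  have h3 := (Finset.card_le_card hcov).trans (Finset.card_union_le _ _)
  omega

/-! ### Three directions -/

/-- Three unit vectors such that every vector has a large product with at least two of them. -/
noncomputable def direction : Fin 3 → Plane :=
  ![!₂[1, 0], !₂[3 / 5, 4 / 5], !₂[-(3 / 5), 4 / 5]]

/-- The linear functional whose level lines have direction `direction w`. -/
noncomputable def transverse (w : Fin 3) (x : Plane) : ℝ :=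
  direction w 0 * x 1 - direction w 1 * x 0

theorem continuous_transverse (w : Fin 3) : Continuous (transverse w) := by
  unfold transverse; fun_prop

theorem direction_norm_sq (w : Fin 3) : direction w 0 ^ 2 + direction w 1 ^ 2 = 1 := by
  fin_cases w <;> simp [direction] <;> norm_num

theorem norm_direction (w : Fin 3) : ‖direction w‖ = 1 := by
  rw [← sq_eq_sq₀ (norm_nonneg _) zero_le_one, plane_norm_sq, direction_norm_sq, one_pow]

/-- The bound `19/50` leaves room in `frontier_injOn_direction`. It is small enough because the
directions are more than `53°` apart: two products below `19/50` with the same vector would make it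
shorter than `429/500`. -/
theorem exists_direction {u v : Plane} (hu : 429 / 500 ≤ ‖u‖) (hv : 429 / 500 ≤ ‖v‖) :
    ∃ w, 19 / 50 ≤ |inner ℝ (direction w) u| ∧ 19 / 50 ≤ |inner ℝ (direction w) v| := by
  have key : ∀ u : Plane, 429 / 500 ≤ ‖u‖ →
      (¬ (|inner ℝ (direction 0) u| < 19 / 50 ∧ |inner ℝ (direction 1) u| < 19 / 50)) ∧
      (¬ (|inner ℝ (direction 0) u| < 19 / 50 ∧ |inner ℝ (direction 2) u| < 19 / 50)) ∧
      (¬ (|inner ℝ (direction 1) u| < 19 / 50 ∧ |inner ℝ (direction 2) u| < 19 / 50)) := by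
    intro u hu
    have h := plane_norm_sq u
    have h' : (429 / 500 : ℝ) ^ 2 ≤ u 0 ^ 2 + u 1 ^ 2 := by rw [← h]; gcongr
    have e0 : inner ℝ (direction 0) u = u 0 := by
      simp [direction, PiLp.inner_apply, Fin.sum_univ_two]
    have e1 : inner ℝ (direction 1) u = 3 / 5 * u 0 + 4 / 5 * u 1 := by
      simp [direction, PiLp.inner_apply, Fin.sum_univ_two]; ring
    have e2 : inner ℝ (direction 2) u = -(3 / 5) * u 0 + 4 / 5 * u 1 := by
      simp [direction, PiLp.inner_apply, Fin.sum_univ_two]; ring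
    rw [e0, e1, e2]
    simp only [abs_lt]
    have hsq : ∀ b c : ℝ, |u 0| ≤ b → |u 1| ≤ c → b ^ 2 + c ^ 2 < (429 / 500) ^ 2 → False := by
      intro b c hb hc hbc
      have h1 := pow_le_pow_left₀ (abs_nonneg _) hb 2
      have h2 := pow_le_pow_left₀ (abs_nonneg _) hc 2
      rw [sq_abs] at h1 h2
      linarith
    refine ⟨?_, ?_, ?_⟩
    · rintro ⟨⟨h1, h2⟩, h3, h4⟩
      exact hsq (19 / 50) (19 / 25) (abs_le.2 ⟨by linarith, by linarith⟩)
        (abs_le.2 ⟨by linarith, by linarith⟩) (by norm_num)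
    · rintro ⟨⟨h1, h2⟩, h3, h4⟩
      exact hsq (19 / 50) (19 / 25) (abs_le.2 ⟨by linarith, by linarith⟩)
        (abs_le.2 ⟨by linarith, by linarith⟩) (by norm_num)
    · rintro ⟨⟨h1, h2⟩, h3, h4⟩
      exact hsq (19 / 30) (19 / 40) (abs_le.2 ⟨by linarith, by linarith⟩)
        (abs_le.2 ⟨by linarith, by linarith⟩) (by norm_num)
  -- each of the two vectors excludes at most one of the three directions
  obtain ⟨a1, a2, a3⟩ := key u hu
  obtain ⟨b1, b2, b3⟩ := key v hv
  by_contra! hcon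
  have c0 := hcon 0
  have c1 := hcon 1
  have c2 := hcon 2
  simp only [← not_lt] at c0 c1 c2
  tauto

theorem frontier_injOn_transverse {R : Set Plane} {a : Plane} (hR : IsCompact R)
    (hRa : ∀ q ∈ R, ‖q - a‖ ≤ 71 / 500) {p : Plane} {w : Fin 3}
    (hw : 19 / 50 ≤ |inner ℝ (direction w) (p - a)|) :
    Set.InjOn (transverse w) (frontier (R + unitDisk) ∩ Metric.closedBall p (1 / 10)) := by
  rintro x ⟨hx, hxp⟩ y ⟨hy, hyp⟩ hxy
  refine (frontier_injOn_direction hR hRa (norm_direction w) hw hx hy hxp hyp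
    (t := direction w 0 * (y 0 - x 0) + direction w 1 * (y 1 - x 1)) ?_).symm
  have h := direction_norm_sq w
  unfold transverse at hxy
  apply plane_ext
  · simp only [PiLp.add_apply, PiLp.smul_apply, smul_eq_mul]
    linear_combination (x 0 - y 0) * h + direction w 1 * hxy
  · simp only [PiLp.add_apply, PiLp.smul_apply, smul_eq_mul]
    linear_combination (x 1 - y 1) * h - direction w 0 * hxy

/-! ### Short pieces of arcs -/

namespace CircularArc

/-- An arc inside a disk of radius `571/500` has length less than `8`. -/
theorem dist_param_le (σ : CircularArc) {a : Plane}
    (h : σ.carrier ⊆ Metric.closedBall a (571 / 500)) (s t : ℝ) :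
    dist (σ.param s) (σ.param t) ≤ 8 * |s - t| := by
  have hd : ∀ s ∈ Set.Icc (0 : ℝ) 1, ∀ t ∈ Set.Icc (0 : ℝ) 1,
      dist (σ.param s) (σ.param t) ≤ 571 / 250 := by
    intro s hs t ht
    rw [carrier_eq] at h
    have h1 := Metric.mem_closedBall.1 (h ⟨s, hs, rfl⟩)
    have h2 := Metric.mem_closedBall.1 (h ⟨t, ht, rfl⟩)
    have h3 := dist_triangle_right (σ.param s) (σ.param t) a
    linarith
  cases σ with
  | segment b c hbc =>
    have h1 := hd 0 (by simp) 1 (by simp)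
    simp only [param, AffineMap.lineMap_apply_zero, AffineMap.lineMap_apply_one] at h1 ⊢
    rw [dist_lineMap_lineMap, Real.dist_eq]
    nlinarith [abs_nonneg (s - t)]
  | arc c ρ θ φ hρ hφ hφ' =>
    have h1 := hd (1 / 2) (by constructor <;> norm_num) 0 (by simp)
    simp only [param] at h1 ⊢
    have hpi := Real.pi_pos
    rw [dist_circlePoint c hρ.le] at h1
    have e : (θ + 1 / 2 * φ - (θ + 0 * φ)) / 2 = φ / 4 := by ring
    rw [e] at h1
    have h2 := Real.mul_le_sin (x := φ / 4) (by positivity) (by linarith)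
    have h3 := le_abs_self (Real.sin (φ / 4))
    have h4 : 2 * ρ * (2 / Real.pi * (φ / 4)) ≤ 571 / 250 :=
      (mul_le_mul_of_nonneg_left (h2.trans h3) (by positivity)).trans h1
    have h5 : 2 * ρ * (2 / Real.pi * (φ / 4)) = ρ * φ / Real.pi := by field_simp; ring
    rw [h5, div_le_iff₀ hpi] at h4
    have h6 : ρ * φ ≤ 8 := by nlinarith [Real.pi_lt_d2]
    refine (dist_circlePoint_le c hρ.le _ _).trans ?_
    have e2 : θ + s * φ - (θ + t * φ) = (s - t) * φ := by ring
    rw [e2, abs_mul, abs_of_pos hφ]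
    nlinarith [abs_nonneg (s - t)]

/-- The `k`-th one of the `160` pieces of an arc of equal length. -/
def piece (σ : CircularArc) (k : ℕ) : Set Plane :=
  σ.param '' Set.Icc ((k : ℝ) / 160) (((k : ℝ) + 1) / 160)

theorem Icc_piece_subset {k : ℕ} (hk : k < 160) :
    Set.Icc ((k : ℝ) / 160) (((k : ℝ) + 1) / 160) ⊆ Set.Icc 0 1 := by
  have h : (k : ℝ) + 1 ≤ 160 := by exact_mod_cast hk
  refine Set.Icc_subset_Icc (by positivity) ?_
  rw [div_le_one (by norm_num)]
  exact h

theorem piece_subset_carrier (σ : CircularArc) {k : ℕ} (hk : k < 160) :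
    σ.piece k ⊆ σ.carrier := by
  rw [carrier_eq]
  exact Set.image_mono (Icc_piece_subset hk)

theorem exists_mem_piece (σ : CircularArc) {p : Plane} (hp : p ∈ σ.carrier) :
    ∃ k < 160, p ∈ σ.piece k := by
  rw [carrier_eq] at hp
  obtain ⟨t, ⟨h0, h1⟩, rfl⟩ := hp
  rcases h1.eq_or_lt with rfl | h1
  · exact ⟨159, by norm_num, 1, by constructor <;> norm_num, rfl⟩
  · refine ⟨⌊t * 160⌋₊, ?_, t, ⟨?_, ?_⟩, rfl⟩
    · rw [Nat.floor_lt (by positivity)]; push_cast; linarith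
    · rw [div_le_iff₀ (by norm_num)]; exact Nat.floor_le (by positivity)
    · rw [le_div_iff₀ (by norm_num)]; exact (Nat.lt_floor_add_one _).le

theorem isCompact_piece (σ : CircularArc) (k : ℕ) : IsCompact (σ.piece k) :=
  isCompact_Icc.image σ.continuous_param

theorem isPreconnected_piece (σ : CircularArc) (k : ℕ) : IsPreconnected (σ.piece k) :=
  isPreconnected_Icc.image _ σ.continuous_param.continuousOn

theorem dist_le_of_mem_piece (σ : CircularArc) {a : Plane}
    (h : σ.carrier ⊆ Metric.closedBall a (571 / 500)) {k : ℕ} {x y : Plane}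
    (hx : x ∈ σ.piece k) (hy : y ∈ σ.piece k) : dist x y ≤ 1 / 20 := by
  obtain ⟨s, hs, rfl⟩ := hx
  obtain ⟨t, ht, rfl⟩ := hy
  have h1 := σ.dist_param_le h s t
  have h2 : |s - t| ≤ 1 / 160 := by
    rw [abs_le]; constructor <;> linarith [hs.1, hs.2, ht.1, ht.2]
  linarith

theorem nontrivial_piece (σ : CircularArc) {k : ℕ} (hk : k < 160) : (σ.piece k).Nontrivial := by
  have hlt : (k : ℝ) / 160 < ((k : ℝ) + 1) / 160 := by linarith
  have h1 : (k : ℝ) / 160 ∈ Set.Icc ((k : ℝ) / 160) (((k : ℝ) + 1) / 160) := ⟨le_rfl, hlt.le⟩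
  have h2 : ((k : ℝ) + 1) / 160 ∈ Set.Icc ((k : ℝ) / 160) (((k : ℝ) + 1) / 160) := ⟨hlt.le, le_rfl⟩
  refine ⟨_, ⟨_, h1, rfl⟩, _, ⟨_, h2, rfl⟩, fun h => ?_⟩
  rcases σ.param_inj (Icc_piece_subset hk h1) (Icc_piece_subset hk h2) h with h | h | h
  · exact hlt.ne h
  · linarith [h.1, h.2]
  · linarith [h.1, h.2]

theorem finite_piece_inter (σ : CircularArc) {k l : ℕ} (hk : k < 160) (hl : l < 160)
    (hkl : k ≠ l) : (σ.piece k ∩ σ.piece l).Finite := by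
  refine (Set.toFinite {σ.param ((k : ℝ) / 160), σ.param (((k : ℝ) + 1) / 160), σ.param 0,
    σ.param 1}).subset ?_
  rintro _ ⟨⟨s, hs, rfl⟩, ⟨t, ht, hst⟩⟩
  simp only [Set.mem_insert_iff, Set.mem_singleton_iff]
  rcases σ.param_inj (Icc_piece_subset hl ht) (Icc_piece_subset hk hs) hst with h | h | h
  · subst h
    rcases lt_or_gt_of_ne hkl with h | h
    · have : (k : ℝ) + 1 ≤ l := by exact_mod_cast h
      right; left
      congr 1
      linarith [hs.2, ht.1]
    · have : (l : ℝ) + 1 ≤ k := by exact_mod_cast h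
      left
      congr 1
      linarith [hs.1, ht.2]
  · rw [h.2]; simp
  · rw [h.2]; simp

end CircularArc

/-- The boundaries of the neighbourhoods of two small sets have only linearly many pairs of meeting
arcs. -/
theorem card_meeting_arcs_le {R R' : Set Plane} {a a' : Plane} (hR : IsCompact R)
    (hRa : ∀ q ∈ R, ‖q - a‖ ≤ 71 / 500) (hR' : IsCompact R')
    (hRa' : ∀ q ∈ R', ‖q - a'‖ ≤ 71 / 500)
    (d : CircularDecomposition (frontier (R + unitDisk)))
    (d' : CircularDecomposition (frontier (R' + unitDisk)))
    (S : Finset (CircularArc × CircularArc))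
    (hS : ∀ x ∈ S, x.1 ∈ d.arcs ∧ x.2 ∈ d'.arcs ∧ (x.1.carrier ∩ x.2.carrier).Nonempty) :
    S.card ≤ 960 * (d.arcs.card + d'.arcs.card) := by
  classical
  have hsub : ∀ {R : Set Plane} (d : CircularDecomposition (frontier (R + unitDisk))),
      ∀ σ ∈ d.arcs, σ.carrier ⊆ frontier (R + unitDisk) := by
    intro R d σ hσ x hx
    rw [← d.union_eq]
    exact Or.inl (Set.mem_biUnion hσ hx)
  have hball : ∀ {R : Set Plane} {a : Plane}, IsCompact R → (∀ q ∈ R, ‖q - a‖ ≤ 71 / 500) →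
      frontier (R + unitDisk) ⊆ Metric.closedBall a (571 / 500) := by
    intro R a hR hRa x hx
    rw [Metric.mem_closedBall, dist_eq_norm]
    exact norm_sub_center_le hR hRa hx
  have hfin : ∀ {R : Set Plane} (d : CircularDecomposition (frontier (R + unitDisk))),
      ∀ i ∈ d.arcs ×ˢ Finset.range 160, ∀ i' ∈ d.arcs ×ˢ Finset.range 160, i ≠ i' →
        (i.1.piece i.2 ∩ i'.1.piece i'.2).Finite := by
    rintro R d ⟨σ, k⟩ hi ⟨τ, l⟩ hi' hne
    obtain ⟨hσ, hk⟩ := Finset.mem_product.1 hi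
    obtain ⟨hτ, hl⟩ := Finset.mem_product.1 hi'
    rw [Finset.mem_range] at hk hl
    by_cases h : σ = τ
    · subst h
      exact σ.finite_piece_inter hk hl fun h => hne (by simp only at h; rw [h])
    · refine σ.endpoints_finite.subset fun x hx => ?_
      exact (d.inter_subset σ hσ τ hτ h
        ⟨σ.piece_subset_carrier hk hx.1, τ.piece_subset_carrier hl hx.2⟩).1
  have hUn : ∀ {R : Set Plane} (d : CircularDecomposition (frontier (R + unitDisk))),
      (⋃ i ∈ d.arcs ×ˢ Finset.range 160, i.1.piece i.2) ⊆ frontier (R + unitDisk) := by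
    intro R d
    refine Set.iUnion₂_subset fun i hi => ?_
    obtain ⟨hσ, hk⟩ := Finset.mem_product.1 hi
    exact (i.1.piece_subset_carrier (Finset.mem_range.1 hk)).trans (hsub d _ hσ)
  have hex : ∀ x : CircularArc × CircularArc, ∃ k l : ℕ, x ∈ S → k < 160 ∧ l < 160 ∧
      (x.1.piece k ∩ x.2.piece l).Nonempty := by
    intro x
    by_cases hx : x ∈ S
    · obtain ⟨-, -, p, hp⟩ := hS x hx
      obtain ⟨k, hk, h1⟩ := x.1.exists_mem_piece hp.1
      obtain ⟨l, hl, h2⟩ := x.2.exists_mem_piece hp.2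
      exact ⟨k, l, fun _ => ⟨hk, hl, p, h1, h2⟩⟩
    · exact ⟨0, 0, fun h => absurd h hx⟩
  choose k l hkl using hex
  set T : Finset ((CircularArc × ℕ) × (CircularArc × ℕ)) :=
    S.image fun x => ((x.1, k x), (x.2, l x)) with hT
  have hTS : T.card = S.card := by
    refine Finset.card_image_of_injective _ ?_
    rintro ⟨σ, τ⟩ ⟨σ', τ'⟩ h
    simp only [Prod.mk.injEq] at h
    rw [h.1.1, h.2.1]
  have hmain := card_intersecting_pairs_le (d.arcs ×ˢ Finset.range 160)
    (d'.arcs ×ˢ Finset.range 160) (fun i => i.1.piece i.2) (fun j => j.1.piece j.2)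
    transverse continuous_transverse
    (fun i hi x hx y hy => i.1.dist_le_of_mem_piece
      ((hsub d _ (Finset.mem_product.1 hi).1).trans (hball hR hRa)) hx hy)
    (fun i hi x hx y hy => i.1.dist_le_of_mem_piece
      ((hsub d' _ (Finset.mem_product.1 hi).1).trans (hball hR' hRa')) hx hy)
    (fun i _ => i.1.isCompact_piece _) (fun i _ => i.1.isCompact_piece _)
    (fun i _ => i.1.isPreconnected_piece _) (fun i _ => i.1.isPreconnected_piece _)
    (fun i hi => i.1.nontrivial_piece (Finset.mem_range.1 (Finset.mem_product.1 hi).2))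
    (fun i hi => i.1.nontrivial_piece (Finset.mem_range.1 (Finset.mem_product.1 hi).2))
    (hfin d) (hfin d')
    (by
      rintro i hi j hj p ⟨hp, hp'⟩
      have h1 := hUn d (Set.mem_biUnion hi hp)
      have h2 := hUn d' (Set.mem_biUnion hj hp')
      obtain ⟨w, hw, hw'⟩ := exists_direction (le_norm_sub_center hR hRa h1)
        (le_norm_sub_center hR' hRa' h2)
      exact ⟨w, (frontier_injOn_transverse hR hRa hw).mono (Set.inter_subset_inter_left _ (hUn d)),
        (frontier_injOn_transverse hR' hRa' hw').mono (Set.inter_subset_inter_left _ (hUn d'))⟩)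
    T
    (by
      intro y hy
      obtain ⟨x, hx, rfl⟩ := Finset.mem_image.1 hy
      obtain ⟨h1, h2, h3⟩ := hkl x hx
      obtain ⟨h4, h5, -⟩ := hS x hx
      exact ⟨Finset.mem_product.2 ⟨h4, Finset.mem_range.2 h1⟩,
        Finset.mem_product.2 ⟨h5, Finset.mem_range.2 h2⟩, h3⟩)
  rw [hTS, Finset.card_product, Finset.card_product, Finset.card_range] at hmain
  omega

/-! ### The intersection -/

namespace CircularArc

/-- The points at which an arc `σ` has to be cut because of an arc `τ` (the points of `τ` on `σ` if
the arcs lie on different curves, and the endpoints of `τ` on `σ`) number at most two. -/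
theorem exists_breakpoints (σ τ : CircularArc) :
    ∃ Y : Finset Plane, Y.card ≤ 2 ∧
      (∀ p ∈ σ.carrier ∩ τ.carrier, σ.curve ≠ τ.curve ∨ p ∈ τ.endpoints → p ∈ Y) ∧
      (¬ (σ.carrier ∩ τ.carrier).Nonempty → Y = ∅) := by
  classical
  by_cases hne : (σ.carrier ∩ τ.carrier).Nonempty
  · by_cases hc : σ.curve = τ.curve
    · refine ⟨{τ.param 0, τ.param 1}, Finset.card_le_two, ?_, fun h => absurd hne h⟩
      rintro p - (h | h)
      · exact absurd hc h
      · rw [endpoints_eq] at h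
        simpa using h
    · obtain ⟨x, y, hxy⟩ := exists_inter_curve_subset_pair hc
      refine ⟨{x, y}, Finset.card_le_two, ?_, fun h => absurd hne h⟩
      intro p hp _
      simpa using hxy ⟨σ.carrier_subset_curve hp.1, τ.carrier_subset_curve hp.2⟩
  · exact ⟨∅, by simp, fun p hp => absurd ⟨p, hp⟩ hne, fun _ => rfl⟩

end CircularArc

theorem mem_frontier_iInter {ι : Type*} [Finite ι] {S : ι → Set Plane} (hS : ∀ i, IsClosed (S i))
    {x : Plane} : x ∈ frontier (⋂ i, S i) ↔ (∀ i, x ∈ S i) ∧ ∃ i, x ∈ frontier (S i) := by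
  simp only [frontier, (isClosed_iInter hS).closure_eq, (hS _).closure_eq,
    interior_iInter_of_finite, Set.mem_sdiff, Set.mem_iInter, not_forall]
  exact and_congr_right fun h => exists_congr fun i => (and_iff_right (h i)).symm

/-- The boundary of the intersection decomposes into the arcs obtained by cutting the arcs of the
individual boundaries at their endpoints and crossings, of which there are `O(r² M)` by
`card_meeting_arcs_le`. -/
theorem exists_decomposition_iInter {r : ℕ} {R : Fin r → Set Plane} {a : Fin r → Plane}
    (hR : ∀ i, IsCompact (R i)) (hRa : ∀ i, ∀ q ∈ R i, ‖q - a i‖ ≤ 71 / 500)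
    (d : ∀ i, CircularDecomposition (frontier (R i + unitDisk))) {M : ℕ}
    (hM : ∀ i, (d i).arcs.card ≤ M) :
    ∃ d' : CircularDecomposition (frontier (⋂ i, (R i + unitDisk))),
      d'.size ≤ 7684 * r ^ 2 * M := by
  classical
  have hcl : ∀ i, IsClosed (R i + unitDisk) := fun i => (isCompact_add_unitDisk (hR i)).isClosed
  set B := frontier (⋂ i, (R i + unitDisk)) with hB
  have hBiff : ∀ x, x ∈ B ↔ (∀ i, x ∈ R i + unitDisk) ∧ ∃ i, x ∈ frontier (R i + unitDisk) :=
    fun x => mem_frontier_iInter hcl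
  set A : Finset (Σ _ : Fin r, CircularArc) := Finset.univ.sigma fun i => (d i).arcs with hA
  have hAmem : ∀ i σ, (⟨i, σ⟩ : Σ _ : Fin r, CircularArc) ∈ A ↔ σ ∈ (d i).arcs := by
    intro i σ
    simp [hA]
  have hAsub : ∀ x ∈ A, x.2.carrier ⊆ frontier (R x.1 + unitDisk) := by
    rintro ⟨i, σ⟩ hx y hy
    rw [← (d i).union_eq]
    exact Or.inl (Set.mem_biUnion ((hAmem i σ).1 hx) hy)
  have hcov : ∀ i, ∀ x ∈ frontier (R i + unitDisk), ∃ σ ∈ (d i).arcs, x ∈ σ.carrier := by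
    intro i x hx
    rw [← (d i).union_eq, points_eq_empty (hR i) (hRa i) (d i), Finset.coe_empty,
      Set.union_empty] at hx
    obtain ⟨σ, hσ, hx⟩ := Set.mem_iUnion₂.1 hx
    exact ⟨σ, hσ, hx⟩
  have hBA : B ⊆ ⋃ x ∈ A, x.2.carrier := by
    intro x hx
    obtain ⟨i, hi⟩ := ((hBiff x).1 hx).2
    obtain ⟨σ, hσ, hxσ⟩ := hcov i x hi
    exact Set.mem_biUnion (x := (⟨i, σ⟩ : Σ _ : Fin r, CircularArc)) ((hAmem i σ).2 hσ) hxσ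
  have hBb : Bornology.IsBounded B :=
    ((A.finite_toSet.isCompact_biUnion fun x _ => x.2.isCompact_carrier).isBounded).subset hBA
  -- the lines and circles carrying the arcs
  set s : Finset (Set Plane) := A.image fun x => x.2.curve with hs
  have hrep : ∀ K : Set Plane, ∃ τ : CircularArc, K ∈ s → τ.carrier ⊆ K ∧ K ∩ B ⊆ τ.carrier := by
    intro K
    by_cases hK : K ∈ s
    · obtain ⟨x, -, rfl⟩ := Finset.mem_image.1 hK
      obtain ⟨τ, h1, h2⟩ := x.2.exists_arc_of_isBounded hBb
      exact ⟨τ, fun _ => ⟨h1, h2⟩⟩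
    · exact ⟨.arc 0 1 0 1 one_pos one_pos (by linarith [Real.pi_gt_three]), fun h => absurd h hK⟩
  choose τ hτ using hrep
  choose Y hY2 hYmem hYempty using CircularArc.exists_breakpoints
  let F : Set Plane → Set Plane := fun K =>
    B ∩ ⋃ x ∈ A.filter (fun x => x.2.curve = K), x.2.carrier
  have hF : ∀ K y, y ∈ F K ↔ y ∈ B ∧ ∃ x ∈ A, x.2.curve = K ∧ y ∈ x.2.carrier := by
    intro K y
    simp only [F, Set.mem_inter_iff, Set.mem_iUnion, Finset.mem_filter, exists_prop, and_assoc]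
  let V : Set Plane → Finset Plane := fun K =>
    (A.filter fun x => x.2.curve = K).biUnion fun x => A.biUnion fun y => Y x.2 y.2
  have hV : ∀ K y, y ∈ V K ↔ ∃ x ∈ A, x.2.curve = K ∧ ∃ x' ∈ A, y ∈ Y x.2 x'.2 := by
    intro K y
    simp only [V, Finset.mem_biUnion, Finset.mem_filter, and_assoc]
  obtain ⟨d', hd'⟩ := exists_circularDecomposition s τ F V ∅
    (by
      intro K hK y hy
      obtain ⟨hyB, x, -, rfl, hyx⟩ := (hF K y).1 hy
      exact (hτ _ hK).2 ⟨x.2.carrier_subset_curve hyx, hyB⟩)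
    (fun K _ => isClosed_frontier.inter
      ((Finset.finite_toSet _).isClosed_biUnion fun x _ => x.2.isCompact_carrier.isClosed))
    (by
      intro K hK y hy hyV
      obtain ⟨hyB, ⟨i₀, σ₀⟩, hx₀, hx₀K, hyx₀⟩ := (hF K y).1 hy
      -- every arc through `y` lies on `K` and does not end in `y`
      have harc : ∀ x' ∈ A, y ∈ x'.2.carrier → x'.2.carrier ∈ nhdsWithin y K := by
        intro x' hx' hyx'
        have h1 : ¬ (σ₀.curve ≠ x'.2.curve ∨ y ∈ x'.2.endpoints) := fun h =>
          hyV ((hV K y).2 ⟨_, hx₀, hx₀K, x', hx', hYmem σ₀ x'.2 y ⟨hyx₀, hyx'⟩ h⟩)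
        rw [not_or, not_not] at h1
        rw [← hx₀K, h1.1]
        exact x'.2.carrier_mem_nhdsWithin_curve hyx' h1.2
      have hall : ∀ i, ∀ᶠ z in nhdsWithin y K, z ∈ R i + unitDisk := by
        intro i
        by_cases hyi : y ∈ frontier (R i + unitDisk)
        · obtain ⟨σ, hσ, hyσ⟩ := hcov i y hyi
          filter_upwards [harc ⟨i, σ⟩ ((hAmem i σ).2 hσ) hyσ] with z hz
          exact (hcl i).frontier_subset (hAsub ⟨i, σ⟩ ((hAmem i σ).2 hσ) hz)
        · have hyint : y ∈ interior (R i + unitDisk) := by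
            by_contra h
            exact hyi ⟨subset_closure (((hBiff y).1 hyB).1 i), h⟩
          exact nhdsWithin_le_nhds (mem_interior_iff_mem_nhds.1 hyint)
      have hmem : F K ∈ nhdsWithin y K := by
        filter_upwards [Filter.eventually_all.2 hall, harc _ hx₀ hyx₀] with z hz hz₀
        exact (hF K z).2 ⟨(hBiff z).2 ⟨hz, i₀, hAsub _ hx₀ hz₀⟩, _, hx₀, hx₀K, hz₀⟩
      exact nhdsWithin_mono y (hτ K hK).1 hmem)
    (by
      rintro K hK L hL hKL y ⟨hyK, hyL⟩
      obtain ⟨-, x, hx, rfl, hyx⟩ := (hF _ y).1 hyK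
      obtain ⟨-, x', hx', rfl, hyx'⟩ := (hF _ y).1 hyL
      exact (hV _ y).2 ⟨x, hx, rfl, x', hx', hYmem _ _ y ⟨hyx, hyx'⟩ (Or.inl hKL)⟩)
  have heq : (⋃ K ∈ s, F K) ∪ ((∅ : Finset Plane) : Set Plane) = B := by
    rw [Finset.coe_empty, Set.union_empty]
    apply Set.Subset.antisymm
    · exact Set.iUnion₂_subset fun K _ => Set.inter_subset_left
    · intro y hy
      obtain ⟨x, hx, hyx⟩ := Set.mem_iUnion₂.1 (hBA hy)
      exact Set.mem_biUnion (Finset.mem_coe.2 (Finset.mem_image_of_mem _ hx))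
        ((hF _ y).2 ⟨hy, x, hx, rfl, hyx⟩)
  -- the breakpoints are counted by pairs of meeting arcs
  have hpair : ∀ i j, ∑ σ ∈ (d i).arcs, ∑ σ' ∈ (d j).arcs, (Y σ σ').card ≤ 3840 * M := by
    intro i j
    set T := ((d i).arcs ×ˢ (d j).arcs).filter
      fun x => (x.1.carrier ∩ x.2.carrier).Nonempty with hT
    have hTcard : T.card ≤ 960 * ((d i).arcs.card + (d j).arcs.card) := by
      refine card_meeting_arcs_le (hR i) (hRa i) (hR j) (hRa j) (d i) (d j) T ?_
      intro x hx
      obtain ⟨h1, h2⟩ := Finset.mem_filter.1 hx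
      exact ⟨(Finset.mem_product.1 h1).1, (Finset.mem_product.1 h1).2, h2⟩
    have h1 : ∑ σ ∈ (d i).arcs, ∑ σ' ∈ (d j).arcs, (Y σ σ').card ≤ T.card * 2 := by
      rw [← Finset.sum_product' (f := fun σ σ' => (Y σ σ').card), ← Finset.sum_filter_of_ne
        (p := fun x => (x.1.carrier ∩ x.2.carrier).Nonempty)]
      · exact Finset.sum_le_card_nsmul _ _ 2 fun x _ => hY2 _ _
      · intro x _ hx
        by_contra h
        exact hx (by rw [hYempty _ _ h, Finset.card_empty])
    have := hM i
    have := hM j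
    omega
  have hVsum : ∑ K ∈ s, (V K).card ≤ r ^ 2 * (3840 * M) := by
    calc ∑ K ∈ s, (V K).card
        ≤ ∑ K ∈ s, ∑ x ∈ A.filter (fun x => x.2.curve = K), ∑ y ∈ A, (Y x.2 y.2).card :=
          Finset.sum_le_sum fun K _ => Finset.card_biUnion_le.trans
            (Finset.sum_le_sum fun x _ => Finset.card_biUnion_le)
      _ = ∑ x ∈ A, ∑ y ∈ A, (Y x.2 y.2).card :=
          Finset.sum_fiberwise_of_maps_to (fun x hx => Finset.mem_image_of_mem _ hx) _
      _ = ∑ i : Fin r, ∑ j : Fin r,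
            ∑ σ ∈ (d i).arcs, ∑ σ' ∈ (d j).arcs, (Y σ σ').card := by
          simp only [hA, Finset.sum_sigma]
          exact Finset.sum_congr rfl fun i _ => Finset.sum_comm
      _ ≤ ∑ i : Fin r, ∑ j : Fin r, 3840 * M :=
          Finset.sum_le_sum fun i _ => Finset.sum_le_sum fun j _ => hpair i j
      _ = r ^ 2 * (3840 * M) := by
          simp only [Finset.sum_const, Finset.card_univ, Fintype.card_fin, smul_eq_mul]
          ring
  have hscard : s.card ≤ r ^ 2 * M := by
    calc s.card ≤ A.card := Finset.card_image_le
      _ = ∑ i : Fin r, (d i).arcs.card := Finset.card_sigma _ _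
      _ ≤ ∑ i : Fin r, M := Finset.sum_le_sum fun i _ => hM i
      _ = r * M := by simp
      _ ≤ r ^ 2 * M := Nat.mul_le_mul_right _ (Nat.le_self_pow two_ne_zero r)
  have hsize : d'.size ≤ 7684 * r ^ 2 * M := by
    rw [Finset.sum_add_distrib, ← Finset.mul_sum, Finset.sum_const, smul_eq_mul,
      Finset.card_empty] at hd'
    nlinarith
  rw [← heq]
  exact ⟨d', hsize⟩

/-- The bound `71/500` is slightly larger than the diagonal `√2/10` of the largest cells. -/
theorem norm_sub_le_of_mem_gridCell {a q : Plane} {ε : ℝ} (hε : ε ≤ 1 / 10)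
    (hq : q ∈ gridCell a ε) : ‖q - a‖ ≤ 71 / 500 := by
  have h0 := hq 0
  have h1 := hq 1
  rw [← sq_le_sq₀ (norm_nonneg _) (by norm_num), plane_norm_sq, PiLp.sub_apply, PiLp.sub_apply]
  nlinarith

theorem exists_size_eq_circularComplexity {S : Set Plane} (hS : IsCircularDomain S) :
    ∃ d : CircularDecomposition (frontier S), d.size = circularComplexity S := by
  obtain ⟨-, ⟨d⟩⟩ := hS
  exact Nat.sInf_mem (s := {n | ∃ d : CircularDecomposition (frontier S), d.size = n}) ⟨_, d, rfl⟩

theorem mainTheorem2 :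
    ∃ C : ℕ, ∀ (ε : ℝ), 0 < ε → ε ≤ 1 / 10 →
      ∀ (r : ℕ) (R : Fin r → Set Plane),
        (∀ i, IsCircularDomain (R i)) →
        (∀ i, ∃ a : Plane, R i ⊆ gridCell a ε) →
        (∀ i, IsCircularDomain (R i + unitDisk)) ∧
        IsCircularDomain (⋂ i, (R i + unitDisk)) ∧
        circularComplexity (⋂ i, (R i + unitDisk)) ≤
          C * r ^ 2 * Finset.univ.sup (fun i => circularComplexity (R i + unitDisk)) := by
  refine ⟨7684, fun ε _ hε r R hdom hcell => ?_⟩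
  choose a ha using hcell
  have hRa : ∀ i, ∀ q ∈ R i, ‖q - a i‖ ≤ 71 / 500 := fun i q hq =>
    norm_sub_le_of_mem_gridCell hε (ha i hq)
  have hR : ∀ i, IsCompact (R i) := by
    intro i
    refine Metric.isCompact_of_isClosed_isBounded (hdom i).1 ?_
    refine (Metric.isBounded_closedBall (x := a i) (r := 71 / 500)).subset fun q hq => ?_
    rw [Metric.mem_closedBall, dist_eq_norm]
    exact hRa i q hq
  have hsum : ∀ i, IsCircularDomain (R i + unitDisk) := fun i =>
    isCircularDomain_add_unitDisk (hR i) (hRa i) (hdom i)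
  choose d hd using fun i => exists_size_eq_circularComplexity (hsum i)
  obtain ⟨d', hd'⟩ := exists_decomposition_iInter hR hRa d
    (M := Finset.univ.sup fun i => circularComplexity (R i + unitDisk)) (by
      intro i
      refine le_trans ?_ (Finset.le_sup (f := fun i => circularComplexity (R i + unitDisk))
        (Finset.mem_univ i))
      simp only [← hd i, CircularDecomposition.size]
      exact Nat.le_add_right _ _)
  refine ⟨hsum, ⟨isClosed_iInter fun i => (hsum i).1, ⟨d'⟩⟩, ?_⟩
  have hle : circularComplexity (⋂ i, (R i + unitDisk)) ≤ d'.size :=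
    Nat.sInf_le (Set.mem_ofPred_eq ▸ ⟨d', rfl⟩)
  exact hle.trans hd'
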